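/- Let $k$ be a field, let $k'$ be a finite dimensional commutative $k$-algebra (hence artinian), and put $V=k'((z))$, $V^+=k'[[z]]$, regarded as $k$-vector spaces. *The determinant central extension.* Two subspaces $A,B\subset V$ are commensurable, $A\sim B$, if $\dim_k (A+B)/(A\cap B)<\infty$. Let $\mathrm{Gl}(V)$ be the group of $k$-linear automorphisms $S$ of $V$ such that $S(V^+)\sim V^+$ and $S^{-1}(V^+)\sim V^+$. For a finite dimensional space $W$ let $\wedge W$ be its top exterior power. Let $\widetilde{\mathrm{Gl}}(V)$ be the set of pairs $(\sigma,S)$ with $S\in \mathrm{Gl}(V)$ and $\sigma$ a $k$-linear isomorphism $$\sigma:\ \wedge\bigl(S(V^+)/(S(V^+)\cap V^+)\bigr)\ \overset{\sim}{\longrightarrow}\ \wedge\bigl(V^+/(S(V^+)\cap V^+)\bigr).$$ (Such a $\sigma$ is the same as a generator of the line of isomorphisms ${\mathbb D}_{S(V^+)}\to{\mathbb D}_{V^+}$, where ${\mathbb D}_A$ is the determinant line bundle with fibre $\wedge(U\cap A)\otimes\wedge(V/(U+A))^*$ at a point $U$ of the infinite Grassmannian of $V$.) If $P\subset M\subset A\cap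 B$ are all commensurable with $V^+$, the identifications $\wedge(A/P)=\wedge(M/P)\otimes\wedge(A/M)$ and $\wedge(B/P)=\wedge(M/P)\otimes\wedge(B/M)$ identify isomorphisms $\wedge(B/M)\simeq\wedge(A/M)$ with isomorphisms $\wedge(B/P)\simeq\wedge(A/P)$. The group law is $(\sigma,S)(\tau,T)=(\sigma\circ S(\tau),ST)$, where $S(\tau)$ is the transport of $\tau$ by $S$ and the composite $\wedge(ST(V^+)/P)\to\wedge(S(V^+)/P)\to\wedge(V^+/P)$ is formed at $P=ST(V^+)\cap S(V^+)\cap V^+$. This is a central extension $$1\to k^*\to\widetilde{\mathrm{Gl}}(V)\to \mathrm{Gl}(V)\to 1 .$$ Let $G=k'((z))^*$, embedded in $\mathrm{Gl}(V)$ by homotheties. For $S,T\in G$ let $\langle S,T\rangle=\tilde S\tilde T\tilde S^{-1}\tilde T^{-1}$, where $\tilde S,\tilde T\in\widetilde{\mathrm{Gl}}(V)$ are lifts of $S,T$. *The valuation.* For $S\in G$ let $\nu(S)$ be the $z$-adic valuation of the image $\bar S$ of $S$ in $(k'/\mathfrak n)((z))$, where $\mathfrak n$ is the nilradical of $k'$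 (so $\nu$ is the usual valuation if $k'$ is a field). Write $h(0)$ for the constant coefficient of $h\in k'((z))$. **Proposition.** Let $S,T\in G$ be such that the leading coefficients of $\bar S$ and $\bar T$ are units of $k'/\mathfrak n$. Then, for all lifts $\tilde S,\tilde T$, the commutator $\langle S,T\rangle$ lies in $k^*$ and $$\langle S,T\rangle=\operatorname{Norm}_{k'/k}\Bigl(\frac{S^{\nu(T)}}{T^{\nu(S)}}(0)\Bigr).$$ If $k'$ is local, in particular if $k'/k$ is a finite field extension, the hypothesis on the leading coefficients holds for every $S\in G$, so the formula holds for all $S,T\in G$. -/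

import Mathlib

open Module

namespace DetExt

section
variable {K : Type*} [Field K] {W : Type*} [AddCommGroup W] [Module K W]

theorem map_pow_eq (X : Submodule K W) (n : ℕ) :
    (X.map (ExteriorAlgebra.ι K)) ^ n
      = (⋀[K]^n X).map (ExteriorAlgebra.map X.subtype).toLinearMap := by
  rw [ExteriorAlgebra.exteriorPower, Submodule.map_pow]
  congr 1
  rw [← LinearMap.range_comp, ExteriorAlgebra.map_comp_ι, LinearMap.range_comp,
    Submodule.range_subtype]

theorem finrank_pow (X : Submodule K W) [FiniteDimensional K X] (n : ℕ) :
    finrank K ↥((X.map (ExteriorAlgebra.ι K)) ^ n) = (finrank K X).choose n := by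
  rw [map_pow_eq, ← exteriorPower.finrank_eq K (M := X) n]
  exact (LinearEquiv.finrank_eq (Submodule.equivMapOfInjective
    (ExteriorAlgebra.map X.subtype).toLinearMap
    (ExteriorAlgebra.map_injective_field (Submodule.ker_subtype X)) _)).symm

instance finite_pow (X : Submodule K W) [FiniteDimensional K X] (n : ℕ) :
    FiniteDimensional K ↥((X.map (ExteriorAlgebra.ι K)) ^ n) := by
  rw [map_pow_eq]; infer_instance

theorem pow_eq_bot (X : Submodule K W) [FiniteDimensional K X] {n : ℕ} (h : finrank K X < n) :
    (X.map (ExteriorAlgebra.ι K)) ^ n = ⊥ := by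
  rw [← Submodule.finrank_eq_zero (R := K), finrank_pow, Nat.choose_eq_zero_of_lt h]

theorem commute_map (X Y : Submodule K W) :
    Commute (X.map (ExteriorAlgebra.ι K)) (Y.map (ExteriorAlgebra.ι K)) := by
  have key : ∀ X Y : Submodule K W, X.map (ExteriorAlgebra.ι K) * Y.map (ExteriorAlgebra.ι K)
      ≤ Y.map (ExteriorAlgebra.ι K) * X.map (ExteriorAlgebra.ι K) := by
    intro X Y
    rw [Submodule.mul_le]
    rintro _ ⟨x, hx, rfl⟩ _ ⟨y, hy, rfl⟩
    rw [eq_neg_of_add_eq_zero_left (ExteriorAlgebra.ι_add_mul_swap x y)]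
    exact neg_mem (Submodule.mul_mem_mul ⟨y, hy, rfl⟩ ⟨x, hx, rfl⟩)
  exact le_antisymm (key X Y) (key Y X)

theorem sup_pow_le (X Y : Submodule K W) [FiniteDimensional K X] [FiniteDimensional K Y] :
    ((X ⊔ Y).map (ExteriorAlgebra.ι K)) ^ (finrank K X + finrank K Y)
      ≤ (X.map (ExteriorAlgebra.ι K)) ^ finrank K X * (Y.map (ExteriorAlgebra.ι K)) ^ finrank K Y := by
  rw [Submodule.map_sup, ← Submodule.add_eq_sup, (commute_map X Y).add_pow]
  rw [Finset.sum_eq_single (finrank K X)]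
  · rw [Nat.add_sub_cancel_left]
    refine Submodule.mul_le.2 fun m hm n hn => ?_
    have : ∀ c : ℕ, (c : Submodule K (ExteriorAlgebra K W)) ≤ 1 := by
      intro c
      induction c with
      | zero => simp
      | succ c ih => rw [Nat.cast_succ, Submodule.add_eq_sup]; exact sup_le ih le_rfl
    obtain ⟨r, rfl⟩ := Submodule.mem_one.1 (this _ hn)
    rw [← Algebra.commutes, ← Algebra.smul_def]
    exact Submodule.smul_mem _ _ hm
  · intro b hb hne
    rcases lt_or_gt_of_ne hne with h | h
    · rw [pow_eq_bot Y (n := finrank K X + finrank K Y - b) (by omega)]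
      simp
    · rw [pow_eq_bot X h]; simp
  · intro h
    simp at h

theorem exists_mul_swap (y : ExteriorAlgebra K W) (m : W) :
    ∃ y', y * ExteriorAlgebra.ι K m = ExteriorAlgebra.ι K m * y' := by
  induction y using CliffordAlgebra.left_induction with
  | algebraMap r => exact ⟨algebraMap _ _ r, Algebra.commutes _ _⟩
  | add x y hx hy =>
    obtain ⟨x', hx⟩ := hx
    obtain ⟨y', hy⟩ := hy
    exact ⟨x' + y', by rw [add_mul, hx, hy, mul_add]⟩
  | ι_mul x v hx =>
    obtain ⟨x', hx⟩ := hx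
    refine ⟨-(ExteriorAlgebra.ι K v * x'), ?_⟩
    rw [mul_assoc, hx, ← mul_assoc]
    have := eq_neg_of_add_eq_zero_left (ExteriorAlgebra.ι_add_mul_swap (R := K) v m)
    erw [this]
    rw [neg_mul, mul_neg, mul_assoc]

end

section
variable {K : Type*} [Field K] {V : Type*} [AddCommGroup V] [Module K V]

/-- The quotient `A / (A ∩ M) = (A + M) / M`, as a subspace of `V / M`. -/
def quo (A M : Submodule K V) : Submodule K (V ⧸ M) := A.map M.mkQ

/-- `A` and `B` are commensurable: `(A + B) / (A ∩ B)` is finite dimensional. -/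
def Commensurable (A B : Submodule K V) : Prop :=
  FiniteDimensional K (quo (A ⊔ B) (A ⊓ B))

/-- The exterior algebra of maximal degree `∧(A / M)`, for `M ⊆ A` with finite dimensional
quotient: the line of top degree elements of the exterior algebra of `A / M`, realised inside
the exterior algebra of `V / M`. -/
noncomputable def line (A M : Submodule K V) : Submodule K (ExteriorAlgebra K (V ⧸ M)) :=
  (quo A M).map (ExteriorAlgebra.ι K) ^ finrank K (quo A M)

/-- For `P ⊆ M`, a linear section of the projection `V / P → V / M`. -/
noncomputable def sec {P M : Submodule K V} (h : P ≤ M) : (V ⧸ M) →ₗ[K] (V ⧸ P) :=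
  ((Submodule.factor h).exists_rightInverse_of_surjective
    (LinearMap.range_eq_top.2 (Submodule.factor_surjective h))).choose

theorem factor_sec {P M : Submodule K V} (h : P ≤ M) (x : V ⧸ M) :
    Submodule.factor h (sec h x) = x :=
  LinearMap.congr_fun ((Submodule.factor h).exists_rightInverse_of_surjective
    (LinearMap.range_eq_top.2 (Submodule.factor_surjective h))).choose_spec x

/-- For `P ⊆ M` and `μ ∈ ∧(M / P)`, the map `x ↦ μ ∧ x̃` from the exterior algebra of `V / M`
to that of `V / P`, where `x̃` is any lift of `x` (see `wedge_map_factor`). -/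
noncomputable def wedge {P M : Submodule K V} (h : P ≤ M) (μ : ExteriorAlgebra K (V ⧸ P)) :
    ExteriorAlgebra K (V ⧸ M) →ₗ[K] ExteriorAlgebra K (V ⧸ P) :=
  LinearMap.mulLeft K μ ∘ₗ (ExteriorAlgebra.map (sec h)).toLinearMap

theorem wedge_apply {P M : Submodule K V} (h : P ≤ M) (μ : ExteriorAlgebra K (V ⧸ P))
    (x : ExteriorAlgebra K (V ⧸ M)) :
    wedge h μ x = μ * ExteriorAlgebra.map (sec h) x := rfl

theorem mem_quo_of_factor_eq_zero {P M : Submodule K V} (h : P ≤ M) {x : V ⧸ P}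
    (hx : Submodule.factor h x = 0) : x ∈ quo M P := by
  obtain ⟨v, rfl⟩ := Submodule.mkQ_surjective _ x
  rw [Submodule.factor_mk] at hx
  exact ⟨v, (Submodule.Quotient.mk_eq_zero M).1 hx, rfl⟩

theorem factor_eq_zero_of_mem_quo {P M : Submodule K V} (h : P ≤ M) {x : V ⧸ P}
    (hx : x ∈ quo M P) : Submodule.factor h x = 0 := by
  obtain ⟨v, hv, rfl⟩ := hx
  rw [Submodule.factor_mk]
  exact (Submodule.Quotient.mk_eq_zero M).2 hv

theorem mul_mul_ι_eq_zero {P M : Submodule K V} [FiniteDimensional K (quo M P)]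
    {μ : ExteriorAlgebra K (V ⧸ P)} (hμ : μ ∈ line M P) {m : V ⧸ P} (hm : m ∈ quo M P)
    (y : ExteriorAlgebra K (V ⧸ P)) : μ * (y * ExteriorAlgebra.ι K m) = 0 := by
  obtain ⟨y', hy'⟩ := exists_mul_swap y m
  have h0 : μ * ExteriorAlgebra.ι K m ∈
      (quo M P).map (ExteriorAlgebra.ι K) ^ (finrank K (quo M P) + 1) := by
    rw [pow_succ]
    exact Submodule.mul_mem_mul hμ ⟨m, hm, rfl⟩
  rw [pow_eq_bot _ (Nat.lt_succ_self _), Submodule.mem_bot] at h0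
  rw [hy', ← mul_assoc, h0, zero_mul]

/-- `wedge h μ x` can be computed with any lift of `x`. -/
theorem wedge_map_factor {P M : Submodule K V} [FiniteDimensional K (quo M P)] (h : P ≤ M)
    {μ : ExteriorAlgebra K (V ⧸ P)} (hμ : μ ∈ line M P) (y : ExteriorAlgebra K (V ⧸ P)) :
    wedge h μ (ExteriorAlgebra.map (Submodule.factor h) y) = μ * y := by
  rw [wedge_apply]
  induction y using CliffordAlgebra.right_induction with
  | algebraMap r =>
    erw [AlgHom.commutes, AlgHom.commutes]
  | add x y hx hy => rw [map_add, map_add, mul_add, hx, hy, mul_add]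
  | mul_ι v x hx =>
    have e : ExteriorAlgebra.map (sec h) (ExteriorAlgebra.map (Submodule.factor h)
        (x * ExteriorAlgebra.ι K v)) = ExteriorAlgebra.map (sec h) (ExteriorAlgebra.map
        (Submodule.factor h) x) * ExteriorAlgebra.ι K (sec h (Submodule.factor h v)) := by
      rw [map_mul, map_mul, ExteriorAlgebra.map_apply_ι, ExteriorAlgebra.map_apply_ι]
    have hm : v - sec h (Submodule.factor h v) ∈ quo M P :=
      mem_quo_of_factor_eq_zero h (by rw [map_sub, factor_sec, sub_self])
    have e2 := mul_mul_ι_eq_zero hμ hm x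
    rw [map_sub, mul_sub, mul_sub, sub_eq_zero] at e2
    refine Eq.trans (congrArg (μ * ·) e) ?_
    show μ * (_ * _) = _
    rw [← mul_assoc, hx, mul_assoc]
    exact e2.symm

theorem quo_fin_of_le {P M A : Submodule K V} (hMA : M ≤ A) [FiniteDimensional K (quo A P)] :
    FiniteDimensional K (quo M P) :=
  Submodule.finiteDimensional_of_le (show quo M P ≤ quo A P from Submodule.map_mono hMA)

theorem map_factor_quo {P M : Submodule K V} (h : P ≤ M) (A : Submodule K V) :
    (quo A P).map (Submodule.factor h) = quo A M := by
  rw [quo, quo, ← Submodule.map_comp, Submodule.factor_comp_mk]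

theorem quo_fin_of_le' {P M : Submodule K V} (h : P ≤ M) (A : Submodule K V)
    [FiniteDimensional K (quo A P)] : FiniteDimensional K (quo A M) := by
  rw [← map_factor_quo h]
  exact Module.Finite.map (quo A P) (Submodule.factor h)

theorem quo_eq_sup {P M A : Submodule K V} (h : P ≤ M) (hMA : M ≤ A) :
    quo A P = quo M P ⊔ (quo A M).map (sec h) := by
  apply le_antisymm
  · intro x hx
    have h1 : x - sec h (Submodule.factor h x) ∈ quo M P :=
      mem_quo_of_factor_eq_zero h (by rw [map_sub, factor_sec, sub_self])
    rw [← sub_add_cancel x (sec h (Submodule.factor h x))]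
    refine Submodule.add_mem_sup h1 ⟨_, ?_, rfl⟩
    rw [← map_factor_quo h]
    exact ⟨x, hx, rfl⟩
  · refine sup_le (Submodule.map_mono hMA) ?_
    rintro _ ⟨y, hy, rfl⟩
    rw [← map_factor_quo h] at hy
    obtain ⟨x, hx, rfl⟩ := hy
    have h1 : x - sec h (Submodule.factor h x) ∈ quo M P :=
      mem_quo_of_factor_eq_zero h (by rw [map_sub, factor_sec, sub_self])
    have h2 := (quo A P).sub_mem hx (Submodule.map_mono hMA h1)
    rwa [sub_sub_cancel] at h2

theorem sec_injective {P M : Submodule K V} (h : P ≤ M) : Function.Injective (sec h) :=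
  Function.LeftInverse.injective (factor_sec h)

theorem finrank_quo {P M A : Submodule K V} (h : P ≤ M) (hMA : M ≤ A)
    [FiniteDimensional K (quo A P)] :
    finrank K (quo A P) = finrank K (quo M P) + finrank K (quo A M) := by
  have := quo_fin_of_le (P := P) hMA
  have := quo_fin_of_le' h A
  have e : finrank K ((quo A M).map (sec h)) = finrank K (quo A M) :=
    (LinearEquiv.finrank_eq (Submodule.equivMapOfInjective _ (sec_injective h) _)).symm
  have d : quo M P ⊓ (quo A M).map (sec h) = ⊥ := by
    rw [eq_bot_iff]
    rintro _ ⟨h1, y, _, rfl⟩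
    have := factor_eq_zero_of_mem_quo h h1
    rw [factor_sec] at this
    simp [this]
  have s := Submodule.finrank_sup_add_finrank_inf_eq (quo M P) ((quo A M).map (sec h))
  rw [d, ← quo_eq_sup h hMA, e] at s
  simpa using s

theorem finrank_line (A M : Submodule K V) [FiniteDimensional K (quo A M)] :
    finrank K (line A M) = 1 := by
  rw [line, finrank_pow, Nat.choose_self]

theorem line_eq_mul {P M A : Submodule K V} (h : P ≤ M) (hMA : M ≤ A)
    [FiniteDimensional K (quo A P)] :
    line A P = line M P * (line A M).map (ExteriorAlgebra.map (sec h)).toLinearMap := by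
  have := quo_fin_of_le (P := P) hMA
  have := quo_fin_of_le' h A
  have e : finrank K ((quo A M).map (sec h)) = finrank K (quo A M) :=
    (LinearEquiv.finrank_eq (Submodule.equivMapOfInjective _ (sec_injective h) _)).symm
  have e2 : (line A M).map (ExteriorAlgebra.map (sec h)).toLinearMap
      = ((quo A M).map (sec h)).map (ExteriorAlgebra.ι K) ^ finrank K (quo A M) := by
    rw [line, Submodule.map_pow]
    congr 1
    rw [← Submodule.map_comp, ExteriorAlgebra.map_comp_ι, Submodule.map_comp]
  rw [e2]
  apply le_antisymm
  · have := sup_pow_le (quo M P) ((quo A M).map (sec h))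
    rw [← quo_eq_sup h hMA, e, ← finrank_quo h hMA] at this
    exact this
  · rw [line, line, finrank_quo h hMA, pow_add]
    refine mul_le_mul' (pow_le_pow_left' ?_ _) (pow_le_pow_left' ?_ _)
    · exact Submodule.map_mono (Submodule.map_mono hMA)
    · apply Submodule.map_mono
      rw [quo_eq_sup h hMA]
      exact le_sup_right

theorem wedge_mem {P M A : Submodule K V} (h : P ≤ M) (hMA : M ≤ A)
    [FiniteDimensional K (quo A P)] {μ : ExteriorAlgebra K (V ⧸ P)} (hμ : μ ∈ line M P)
    {x : ExteriorAlgebra K (V ⧸ M)} (hx : x ∈ line A M) : wedge h μ x ∈ line A P := by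
  rw [line_eq_mul h hMA]
  exact Submodule.mul_mem_mul hμ ⟨x, hx, rfl⟩

theorem exists_wedge_eq {P M A : Submodule K V} (h : P ≤ M) (hMA : M ≤ A)
    [FiniteDimensional K (quo A P)] {μ : ExteriorAlgebra K (V ⧸ P)} (hμ : μ ∈ line M P)
    (h0 : μ ≠ 0) {y : ExteriorAlgebra K (V ⧸ P)} (hy : y ∈ line A P) :
    ∃ x ∈ line A M, wedge h μ x = y := by
  have := quo_fin_of_le (P := P) hMA
  rw [line_eq_mul h hMA] at hy
  induction hy using Submodule.mul_induction_on' with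
  | mem_mul_mem m hm n hn =>
    obtain ⟨x, hx, rfl⟩ := hn
    have h1 := (finrank_eq_one_iff_of_nonzero' (⟨μ, hμ⟩ : line M P)
      (by simpa using h0)).1 (finrank_line M P) ⟨m, hm⟩
    obtain ⟨c, hc⟩ := h1
    have hc' : c • μ = m := congrArg Subtype.val hc
    refine ⟨c • x, Submodule.smul_mem _ _ hx, ?_⟩
    rw [map_smul, wedge_apply, ← hc', smul_mul_assoc]
    rfl
  | add x hx y hy h1 h2 =>
    obtain ⟨a, ha, rfl⟩ := h1
    obtain ⟨b, hb, rfl⟩ := h2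
    exact ⟨a + b, Submodule.add_mem _ ha hb, map_add _ _ _⟩

/-- For `P ⊆ M ⊆ A` and `0 ≠ μ ∈ ∧(M / P)`, the isomorphism `∧(A / M) ≃ ∧(A / P)`,
`x ↦ μ ∧ x̃`. -/
noncomputable def wedgeEquiv {P M A : Submodule K V} (h : P ≤ M) (hMA : M ≤ A)
    [FiniteDimensional K (quo A P)] {μ : ExteriorAlgebra K (V ⧸ P)} (hμ : μ ∈ line M P)
    (h0 : μ ≠ 0) : line A M ≃ₗ[K] line A P := by
  have := quo_fin_of_le' h A
  refine LinearEquiv.ofBijective ((wedge h μ).restrict fun x hx => wedge_mem h hMA hμ hx) ?_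
  have hs : Function.Surjective ((wedge h μ).restrict fun x hx => wedge_mem h hMA hμ hx) := by
    rintro ⟨y, hy⟩
    obtain ⟨x, hx, e⟩ := exists_wedge_eq h hMA hμ h0 hy
    exact ⟨⟨x, hx⟩, Subtype.ext e⟩
  have : FiniteDimensional K (line A M) := finite_pow _ _
  have : FiniteDimensional K (line A P) := finite_pow _ _
  exact ⟨(LinearMap.injective_iff_surjective_of_finrank_eq_finrank
    (by rw [finrank_line, finrank_line])).2 hs, hs⟩

theorem wedgeEquiv_coe {P M A : Submodule K V} (h : P ≤ M) (hMA : M ≤ A)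
    [FiniteDimensional K (quo A P)] {μ : ExteriorAlgebra K (V ⧸ P)} (hμ : μ ∈ line M P)
    (h0 : μ ≠ 0) (x : line A M) :
    (wedgeEquiv h hMA hμ h0 x : ExteriorAlgebra K (V ⧸ P)) = wedge h μ x := rfl

theorem exists_ne_zero (A M : Submodule K V) [FiniteDimensional K (quo A M)] :
    ∃ μ ∈ line A M, μ ≠ 0 := by
  have : Nontrivial (line A M) := by
    apply Module.nontrivial_of_finrank_pos (R := K)
    rw [finrank_line]; exact one_pos
  obtain ⟨x, hx⟩ := exists_ne (0 : line A M)
  exact ⟨x, x.2, by simpa using hx⟩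
theorem quo_le_sup {P M : Submodule K V} (h : P ≤ M) (A : Submodule K V) :
    quo A P ≤ quo M P ⊔ (quo A M).map (sec h) := by
  intro x hx
  have h1 : x - sec h (Submodule.factor h x) ∈ quo M P :=
    mem_quo_of_factor_eq_zero h (by rw [map_sub, factor_sec, sub_self])
  rw [← sub_add_cancel x (sec h (Submodule.factor h x))]
  refine Submodule.add_mem_sup h1 ⟨_, ?_, rfl⟩
  rw [← map_factor_quo h]
  exact ⟨x, hx, rfl⟩

theorem quo_eq_bot {A M : Submodule K V} (h : A ≤ M) : quo A M = ⊥ := by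
  rw [eq_bot_iff]
  rintro _ ⟨v, hv, rfl⟩
  exact (Submodule.Quotient.mk_eq_zero M).2 (h hv)

theorem fin_of_le {A M : Submodule K V} (h : A ≤ M) : FiniteDimensional K (quo A M) := by
  rw [quo_eq_bot h]
  infer_instance

theorem fin_trans {A M P : Submodule K V} (h1 : FiniteDimensional K (quo A M))
    (h2 : FiniteDimensional K (quo M P)) : FiniteDimensional K (quo A P) := by
  have h3 : FiniteDimensional K (quo A (M ⊔ P)) := quo_fin_of_le' le_sup_left A
  have h4 : quo (M ⊔ P) P = quo M P := by
    rw [quo, Submodule.map_sup]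
    change quo M P ⊔ quo P P = quo M P
    rw [quo_eq_bot le_rfl, sup_bot_eq]
  have h5 := quo_le_sup (le_sup_right : P ≤ M ⊔ P) A
  rw [h4] at h5
  exact Submodule.finiteDimensional_of_le h5

theorem fin_sup {A B M : Submodule K V} (h1 : FiniteDimensional K (quo A M))
    (h2 : FiniteDimensional K (quo B M)) : FiniteDimensional K (quo (A ⊔ B) M) := by
  have : quo (A ⊔ B) M = quo A M ⊔ quo B M := Submodule.map_sup _ _ _
  rw [this]
  infer_instance

theorem fin_inf {A M N : Submodule K V} (h1 : FiniteDimensional K (quo A M))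
    (h2 : FiniteDimensional K (quo A N)) : FiniteDimensional K (quo A (M ⊓ N)) := by
  let f : quo A (M ⊓ N) →ₗ[K] quo A M × quo A N :=
    LinearMap.prod
      ((Submodule.factor (inf_le_left : M ⊓ N ≤ M)).restrict
        fun x hx => by rw [← map_factor_quo inf_le_left]; exact ⟨x, hx, rfl⟩)
      ((Submodule.factor (inf_le_right : M ⊓ N ≤ N)).restrict
        fun x hx => by rw [← map_factor_quo inf_le_right]; exact ⟨x, hx, rfl⟩)
  apply FiniteDimensional.of_injective f
  rw [← LinearMap.ker_eq_bot, eq_bot_iff]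
  rintro ⟨x, hx⟩ h
  obtain ⟨v, rfl⟩ := Submodule.mkQ_surjective _ x
  have e1 : Submodule.factor (inf_le_left : M ⊓ N ≤ M) ((M ⊓ N).mkQ v) = 0 :=
    congrArg Subtype.val (congrArg Prod.fst (LinearMap.mem_ker.1 h))
  have e2 : Submodule.factor (inf_le_right : M ⊓ N ≤ N) ((M ⊓ N).mkQ v) = 0 :=
    congrArg Subtype.val (congrArg Prod.snd (LinearMap.mem_ker.1 h))
  rw [Submodule.factor_mk] at e1 e2
  rw [Submodule.mem_bot]
  apply Subtype.ext
  exact (Submodule.Quotient.mk_eq_zero _).2 ⟨(Submodule.Quotient.mk_eq_zero M).1 e1,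
    (Submodule.Quotient.mk_eq_zero N).1 e2⟩

theorem commensurable_iff {A B : Submodule K V} : Commensurable A B ↔
    FiniteDimensional K (quo A B) ∧ FiniteDimensional K (quo B A) := by
  constructor
  · intro h
    have h : FiniteDimensional K (quo (A ⊔ B) (A ⊓ B)) := h
    have h1 : FiniteDimensional K (quo A (A ⊓ B)) := quo_fin_of_le (A := A ⊔ B) le_sup_left
    have h2 : FiniteDimensional K (quo B (A ⊓ B)) := quo_fin_of_le (A := A ⊔ B) le_sup_right
    exact ⟨quo_fin_of_le' (P := A ⊓ B) inf_le_right A,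
      quo_fin_of_le' (P := A ⊓ B) inf_le_left B⟩
  · rintro ⟨h1, h2⟩
    exact fin_sup (fin_inf (fin_of_le le_rfl) h1) (fin_inf h2 (fin_of_le le_rfl))

theorem Commensurable.symm {A B : Submodule K V} (h : Commensurable A B) : Commensurable B A :=
  commensurable_iff.2 (commensurable_iff.1 h).symm

theorem Commensurable.refl (A : Submodule K V) : Commensurable A A :=
  commensurable_iff.2 ⟨fin_of_le le_rfl, fin_of_le le_rfl⟩

theorem Commensurable.trans {A B C : Submodule K V} (h : Commensurable A B)
    (h' : Commensurable B C) : Commensurable A C := by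
  rw [commensurable_iff] at *
  exact ⟨fin_trans h.1 h'.1, fin_trans h'.2 h.2⟩

theorem Commensurable.inf {A B C : Submodule K V} (h : Commensurable A C)
    (h' : Commensurable B C) : Commensurable (A ⊓ B) C := by
  rw [commensurable_iff] at *
  exact ⟨fin_trans (fin_of_le inf_le_left) h.1, fin_inf h.2 h'.2⟩

/-- The image `S(A)`, written as the inverse image of `A` under `S⁻¹`. -/
def img (S : V ≃ₗ[K] V) (A : Submodule K V) : Submodule K V := A.comap (S.symm : V →ₗ[K] V)

theorem map_eq_img (S : V ≃ₗ[K] V) (A : Submodule K V) : A.map (S : V →ₗ[K] V) = img S A :=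
  Submodule.map_equiv_eq_comap_symm S A

theorem img_inf (S : V ≃ₗ[K] V) (A B : Submodule K V) : img S (A ⊓ B) = img S A ⊓ img S B := rfl

theorem img_mul (S T : V ≃ₗ[K] V) (A : Submodule K V) : img (S * T) A = img S (img T A) := rfl

theorem img_one (A : Submodule K V) : img (1 : V ≃ₗ[K] V) A = A := rfl

theorem img_mono (S : V ≃ₗ[K] V) {A B : Submodule K V} (h : A ≤ B) : img S A ≤ img S B :=
  Submodule.comap_mono h

theorem img_inv_img (S : V ≃ₗ[K] V) (A : Submodule K V) : img S (img S⁻¹ A) = A := by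
  rw [← img_mul, mul_inv_cancel, img_one]

/-- The isomorphism `V / M ≃ V / M'` induced by `S`, where `M' = S(M)`. -/
def quoMap (S : V ≃ₗ[K] V) {M M' : Submodule K V} (hM : img S M = M') : (V ⧸ M) ≃ₗ[K] (V ⧸ M') :=
  Submodule.Quotient.equiv M M' S ((map_eq_img S M).trans hM)

theorem quoMap_mkQ (S : V ≃ₗ[K] V) {M M' : Submodule K V} (hM : img S M = M') (v : V) :
    quoMap S hM (M.mkQ v) = M'.mkQ (S v) := rfl

theorem map_quoMap_quo (S : V ≃ₗ[K] V) {A A' M M' : Submodule K V} (hA : img S A = A')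
    (hM : img S M = M') : (quo A M).map (quoMap S hM : (V ⧸ M) →ₗ[K] _) = quo A' M' := by
  subst hA
  rw [quo, quo, ← Submodule.map_comp, ← map_eq_img S A, ← Submodule.map_comp]
  rfl

theorem fin_img (S : V ≃ₗ[K] V) {A M : Submodule K V} (h : FiniteDimensional K (quo A M)) :
    FiniteDimensional K (quo (img S A) (img S M)) := by
  rw [← map_quoMap_quo S rfl rfl]
  infer_instance

theorem Commensurable.img (S : V ≃ₗ[K] V) {A B : Submodule K V} (h : Commensurable A B) :
    Commensurable (img S A) (img S B) := by
  rw [commensurable_iff] at *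
  exact ⟨fin_img S h.1, fin_img S h.2⟩

/-- The map of exterior algebras induced by `quoMap`. -/
noncomputable def extMap (S : V ≃ₗ[K] V) {M M' : Submodule K V} (hM : img S M = M') :
    ExteriorAlgebra K (V ⧸ M) →ₐ[K] ExteriorAlgebra K (V ⧸ M') :=
  ExteriorAlgebra.map (quoMap S hM : (V ⧸ M) →ₗ[K] _)

theorem extMap_injective (S : V ≃ₗ[K] V) {M M' : Submodule K V} (hM : img S M = M') :
    Function.Injective (extMap S hM) :=
  ExteriorAlgebra.map_injective_field (LinearEquiv.ker _)

theorem map_extMap_line (S : V ≃ₗ[K] V) {A A' M M' : Submodule K V} (hA : img S A = A')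
    (hM : img S M = M') : (line A M).map (extMap S hM).toLinearMap = line A' M' := by
  have e : finrank K (quo A M) = finrank K (quo A' M') := by
    rw [← map_quoMap_quo S hA hM]
    exact (LinearEquiv.finrank_map_eq (quoMap S hM) (quo A M)).symm
  rw [line, line, Submodule.map_pow, ← e, ← map_quoMap_quo S hA hM, ← Submodule.map_comp,
    ← Submodule.map_comp, extMap, ExteriorAlgebra.map_comp_ι]

/-- The isomorphism `∧(A / M) ≃ ∧(A' / M')` induced by `S`, where `A' = S(A)`, `M' = S(M)`. -/
noncomputable def lineMap (S : V ≃ₗ[K] V) {A A' M M' : Submodule K V} (hA : img S A = A')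
    (hM : img S M = M') : line A M ≃ₗ[K] line A' M' :=
  Submodule.equivMapOfInjective (extMap S hM).toLinearMap (extMap_injective S hM) (line A M) ≪≫ₗ
    LinearEquiv.ofEq _ _ (map_extMap_line S hA hM)

theorem lineMap_coe (S : V ≃ₗ[K] V) {A A' M M' : Submodule K V} (hA : img S A = A')
    (hM : img S M = M') (x : line A M) :
    (lineMap S hA hM x : ExteriorAlgebra K (V ⧸ M')) = extMap S hM x := rfl

/-- Isomorphisms of lines `∧(B / M) ≃ ∧(A / M)`. -/
abbrev DetIso (M B A : Submodule K V) : Type _ := line B M ≃ₗ[K] line A M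

/-- Transport of an isomorphism `∧(B / M) ≃ ∧(A / M)` by `S`: the isomorphism
`∧(B' / M') ≃ ∧(A' / M')`, where `M' = S(M)`, `B' = S(B)`, `A' = S(A)`. -/
noncomputable def transport (S : V ≃ₗ[K] V) {M B A M' B' A' : Submodule K V} (hM : img S M = M')
    (hB : img S B = B') (hA : img S A = A') (σ : DetIso M B A) : DetIso M' B' A' :=
  (lineMap S hB hM).symm ≪≫ₗ σ ≪≫ₗ lineMap S hA hM

theorem transport_apply (S : V ≃ₗ[K] V) {M B A M' B' A' : Submodule K V} (hM : img S M = M')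
    (hB : img S B = B') (hA : img S A = A') (σ : DetIso M B A)
    (x : line B M) : transport S hM hB hA σ (lineMap S hB hM x) = lineMap S hA hM (σ x) := by
  simp [transport]

/-- `σ'` is the stabilisation of `σ`: for `P ⊆ M`, the isomorphisms `∧(B / M) ≃ ∧(A / M)` and
`∧(B / P) ≃ ∧(A / P)` correspond under `∧(A / P) = ∧(M / P) ⊗ ∧(A / M)` and
`∧(B / P) = ∧(M / P) ⊗ ∧(B / M)`. -/
def IsStab {P M B A : Submodule K V} (h : P ≤ M) (σ : DetIso M B A) (σ' : DetIso P B A) : Prop :=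
  ∀ μ ∈ line M P, ∀ (x : line B M) (y : line B P), (y : ExteriorAlgebra K (V ⧸ P)) = wedge h μ x →
    (σ' y : ExteriorAlgebra K (V ⧸ P)) = wedge h μ (σ x)

/-- The stabilisation of `σ`. -/
noncomputable def stab {P M B A : Submodule K V} (h : P ≤ M) (hB : M ≤ B) (hA : M ≤ A)
    [FiniteDimensional K (quo B P)] [FiniteDimensional K (quo A P)] [FiniteDimensional K (quo M P)]
    : DetIso M B A ≃ DetIso P B A where
  toFun σ := (wedgeEquiv h hB (exists_ne_zero M P).choose_spec.1
      (exists_ne_zero M P).choose_spec.2).symm ≪≫ₗ σ ≪≫ₗ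
    (wedgeEquiv h hA (exists_ne_zero M P).choose_spec.1 (exists_ne_zero M P).choose_spec.2)
  invFun σ := (wedgeEquiv h hB (exists_ne_zero M P).choose_spec.1
      (exists_ne_zero M P).choose_spec.2) ≪≫ₗ σ ≪≫ₗ
    (wedgeEquiv h hA (exists_ne_zero M P).choose_spec.1 (exists_ne_zero M P).choose_spec.2).symm
  left_inv σ := by ext; simp
  right_inv σ := by ext; simp

theorem isStab_iff {P M B A : Submodule K V} (h : P ≤ M) (hB : M ≤ B) (hA : M ≤ A)
    [FiniteDimensional K (quo B P)] [FiniteDimensional K (quo A P)] [FiniteDimensional K (quo M P)]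
    (σ : DetIso M B A) (σ' : DetIso P B A) : IsStab h σ σ' ↔ σ' = stab h hB hA σ := by
  obtain ⟨hm, h0⟩ := (exists_ne_zero M P).choose_spec
  constructor
  · intro hs
    ext y
    obtain ⟨x, rfl⟩ := (wedgeEquiv h hB hm h0).surjective y
    have := hs _ hm x (wedgeEquiv h hB hm h0 x) rfl
    rw [this, stab]
    simp [wedgeEquiv_coe]
  · rintro rfl μ hμ x y hy
    obtain ⟨c, hc⟩ := (finrank_eq_one_iff_of_nonzero' (⟨_, hm⟩ : line M P)
      (by simpa using h0)).1 (finrank_line M P) ⟨μ, hμ⟩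
    have hc' : c • (exists_ne_zero M P).choose = μ := congrArg Subtype.val hc
    have hy' : y = c • wedgeEquiv h hB hm h0 x := by
      apply Subtype.ext
      rw [hy, ← hc', Submodule.coe_smul, wedgeEquiv_coe, wedge_apply, wedge_apply, smul_mul_assoc]
    rw [hy', map_smul, Submodule.coe_smul, ← hc', wedge_apply, smul_mul_assoc]
    simp [stab, wedgeEquiv_coe, wedge_apply]

theorem IsStab.comp {P M A B C : Submodule K V} {h : P ≤ M} {σ : DetIso M B A}
    {σ' : DetIso P B A} {τ : DetIso M C B} {τ' : DetIso P C B} (hσ : IsStab h σ σ')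
    (hτ : IsStab h τ τ') : IsStab h (τ ≪≫ₗ σ) (τ' ≪≫ₗ σ') := fun μ hμ x y hy =>
  hσ μ hμ (τ x) (τ' y) (hτ μ hμ x y hy)

theorem wedge_wedge {R P M : Submodule K V} (h' : R ≤ P) (h : P ≤ M)
    [FiniteDimensional K (quo M R)] {ν : ExteriorAlgebra K (V ⧸ R)} (hν : ν ∈ line P R)
    {μ : ExteriorAlgebra K (V ⧸ P)} (hμ : μ ∈ line M P) (x : ExteriorAlgebra K (V ⧸ M)) :
    wedge h' ν (wedge h μ x) = wedge (h'.trans h) (wedge h' ν μ) x := by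
  have hm := wedge_mem h' h hν hμ
  have e : ExteriorAlgebra.map (Submodule.factor (h'.trans h))
      (ExteriorAlgebra.map (sec h') (ExteriorAlgebra.map (sec h) x)) = x := by
    have : ((ExteriorAlgebra.map (Submodule.factor (h'.trans h))).comp
      ((ExteriorAlgebra.map (sec h')).comp (ExteriorAlgebra.map (sec h)))) = AlgHom.id K _ := by
      rw [ExteriorAlgebra.map_comp_map, ExteriorAlgebra.map_comp_map, ← ExteriorAlgebra.map_id]
      congr 1
      ext y
      change Submodule.factor (h'.trans h) (sec h' (sec h (M.mkQ y))) = M.mkQ y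
      rw [← Submodule.factor_comp_apply h' h, factor_sec, factor_sec]
    exact DFunLike.congr_fun this x
  conv_rhs => rw [← e]
  rw [wedge_map_factor _ hm, wedge_apply, wedge_apply, wedge_apply, map_mul, mul_assoc]

theorem IsStab.factor {R P M A B : Submodule K V} {h' : R ≤ P} {h : P ≤ M} (hB : M ≤ B)
    [FiniteDimensional K (quo B R)]
    {σ : DetIso M B A} {σ' : DetIso P B A} {σ'' : DetIso R B A} (h1 : IsStab h σ σ')
    (h2 : IsStab (h'.trans h) σ σ'') : IsStab h' σ' σ'' := by
  have : FiniteDimensional K (quo B P) := quo_fin_of_le' h' B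
  have : FiniteDimensional K (quo M R) := quo_fin_of_le hB
  have : FiniteDimensional K (quo M P) := quo_fin_of_le hB
  obtain ⟨μ, hμ, h0⟩ := exists_ne_zero M P
  intro ν hν x' y hy
  obtain ⟨x, rfl⟩ := (wedgeEquiv h hB hμ h0).surjective x'
  rw [wedgeEquiv_coe, wedge_wedge h' h hν hμ] at hy
  rw [h2 _ (wedge_mem h' h hν hμ) x y hy, ← wedge_wedge h' h hν hμ,
    h1 μ hμ x (wedgeEquiv h hB hμ h0 x) rfl]

theorem IsStab.trans {R P M A B : Submodule K V} {h' : R ≤ P} {h : P ≤ M} (hB : M ≤ B) (hA : M ≤ A)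
    [FiniteDimensional K (quo A R)] [FiniteDimensional K (quo B R)]
    {σ : DetIso M B A} {σ' : DetIso P B A} {σ'' : DetIso R B A} (h1 : IsStab h σ σ')
    (h2 : IsStab h' σ' σ'') : IsStab (h'.trans h) σ σ'' := by
  have : FiniteDimensional K (quo M R) := quo_fin_of_le hB
  have : FiniteDimensional K (quo P R) := quo_fin_of_le (h.trans hB)
  rw [isStab_iff h' (h.trans hB) (h.trans hA)] at h2
  rw [isStab_iff (h'.trans h) hB hA]
  have h3 := (isStab_iff (h'.trans h) hB hA σ _).2 rfl
  have h4 := IsStab.factor (h' := h') hB h1 h3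
  rw [isStab_iff h' (h.trans hB) (h.trans hA)] at h4
  rw [h2, h4]

theorem extMap_wedge (S : V ≃ₗ[K] V) {P M P' M' : Submodule K V} (h : P ≤ M) (h' : P' ≤ M')
    (hP : img S P = P') (hM : img S M = M')
    [FiniteDimensional K (quo M P)] {μ : ExteriorAlgebra K (V ⧸ P)} (hμ : μ ∈ line M P)
    (x : ExteriorAlgebra K (V ⧸ M)) :
    extMap S hP (wedge h μ x) = wedge h' (extMap S hP μ) (extMap S hM x) := by
  have hm : extMap S hP μ ∈ line M' P' := by
    rw [← map_extMap_line S hM hP]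
    exact ⟨μ, hμ, rfl⟩
  have : FiniteDimensional K (quo M' P') := by
    subst hM hP
    exact fin_img S inferInstance
  have e : extMap S hM x = ExteriorAlgebra.map (Submodule.factor h')
      (extMap S hP (ExteriorAlgebra.map (sec h) x)) := by
    have : extMap S hM = ((ExteriorAlgebra.map (Submodule.factor h')).comp
      ((extMap S hP).comp (ExteriorAlgebra.map (sec h)))) := by
      rw [extMap, extMap, ExteriorAlgebra.map_comp_map, ExteriorAlgebra.map_comp_map]
      congr 1
      refine LinearMap.ext fun y => ?_
      have hy : y = Submodule.factor h (sec h y) := (factor_sec h y).symm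
      obtain ⟨v, hv⟩ := Submodule.mkQ_surjective _ (sec h y)
      rw [← hv, Submodule.factor_mk] at hy
      change quoMap S hM y = Submodule.factor h' (quoMap S hP (sec h y))
      rw [← hv, quoMap_mkQ, Submodule.factor_mk, hy, quoMap_mkQ]
    exact DFunLike.congr_fun this x
  rw [e, wedge_map_factor _ hm, wedge_apply, map_mul]

theorem IsStab.transport (S : V ≃ₗ[K] V) {P M B A P' M' B' A' : Submodule K V} {h : P ≤ M}
    (h' : P' ≤ M') (hMB : M ≤ B) (hP : img S P = P') (hM : img S M = M') (hB : img S B = B')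
    (hA : img S A = A') [FiniteDimensional K (quo B P)]
    {σ : DetIso M B A} {σ' : DetIso P B A} (hs : IsStab h σ σ') :
    IsStab h' (transport S hM hB hA σ) (transport S hP hB hA σ') := by
  have : FiniteDimensional K (quo M P) := quo_fin_of_le hMB
  intro μ hμ x y hy
  rw [← map_extMap_line S hM hP] at hμ
  obtain ⟨μ, hμ, rfl⟩ := hμ
  obtain ⟨x, rfl⟩ := (lineMap S hB hM).surjective x
  obtain ⟨y, rfl⟩ := (lineMap S hB hP).surjective y
  rw [transport_apply, transport_apply, lineMap_coe, lineMap_coe]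
  rw [lineMap_coe, lineMap_coe] at hy
  have hy' : (y : ExteriorAlgebra K (V ⧸ P)) = wedge h μ x := by
    apply extMap_injective S hP
    rw [extMap_wedge S h h' hP hM hμ]
    exact hy
  rw [hs μ hμ x y hy', extMap_wedge S h h' hP hM hμ]
  rfl

theorem lineMap_mul (S T : V ≃ₗ[K] V) {M A M' A' M'' A'' : Submodule K V} (hM : img T M = M')
    (hA : img T A = A') (hM' : img S M' = M'') (hA' : img S A' = A'') (hM'' : img (S * T) M = M'')
    (hA'' : img (S * T) A = A'') (x : line A M) :
    lineMap (S * T) hA'' hM'' x = lineMap S hA' hM' (lineMap T hA hM x) := by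
  apply Subtype.ext
  rw [lineMap_coe, lineMap_coe, lineMap_coe]
  have : extMap (S * T) hM'' = (extMap S hM').comp (extMap T hM) := by
    rw [extMap, extMap, extMap, ExteriorAlgebra.map_comp_map]
    congr 1
    refine LinearMap.ext fun y => ?_
    obtain ⟨v, rfl⟩ := Submodule.mkQ_surjective _ y
    rfl
  exact DFunLike.congr_fun this (x : ExteriorAlgebra K (V ⧸ M))

theorem transport_mul (S T : V ≃ₗ[K] V) {M B A M' B' A' M'' B'' A'' : Submodule K V}
    (hM : img T M = M') (hB : img T B = B') (hA : img T A = A')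
    (hM' : img S M' = M'') (hB' : img S B' = B'') (hA' : img S A' = A'')
    (hM'' : img (S * T) M = M'') (hB'' : img (S * T) B = B'') (hA'' : img (S * T) A = A'')
    (σ : DetIso M B A) :
    transport (S * T) hM'' hB'' hA'' σ = transport S hM' hB' hA' (transport T hM hB hA σ) := by
  refine LinearEquiv.ext fun y => ?_
  obtain ⟨x, rfl⟩ := (lineMap (S * T) hB'' hM'').surjective y
  rw [transport_apply, lineMap_mul S T hM hB hM' hB' hM'' hB'', transport_apply, transport_apply,
    lineMap_mul S T hM hA hM' hA' hM'' hA'']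

theorem transport_one {M B A : Submodule K V} (hM : img (1 : V ≃ₗ[K] V) M = M)
    (hB : img (1 : V ≃ₗ[K] V) B = B) (hA : img (1 : V ≃ₗ[K] V) A = A) (σ : DetIso M B A) :
    transport (1 : V ≃ₗ[K] V) hM hB hA σ = σ := by
  have key : ∀ {A : Submodule K V} (hA : img (1 : V ≃ₗ[K] V) A = A) (x : line A M),
      lineMap (1 : V ≃ₗ[K] V) hA hM x = x := by
    intro A hA x
    apply Subtype.ext
    rw [lineMap_coe]
    have : extMap (1 : V ≃ₗ[K] V) hM = AlgHom.id K _ := by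
      rw [extMap, ← ExteriorAlgebra.map_id]
      congr 1
      refine LinearMap.ext fun y => ?_
      obtain ⟨v, rfl⟩ := Submodule.mkQ_surjective _ y
      rfl
    exact DFunLike.congr_fun this (x : ExteriorAlgebra K (V ⧸ M))
  refine LinearEquiv.ext fun y => ?_
  have := transport_apply (1 : V ≃ₗ[K] V) hM hB hA σ y
  rw [key, key] at this
  exact this

theorem transport_comp (S : V ≃ₗ[K] V) {M A B C M' A' B' C' : Submodule K V} (hM : img S M = M')
    (hA : img S A = A') (hB : img S B = B') (hC : img S C = C') (σ : DetIso M B A)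
    (τ : DetIso M C B) :
    transport S hM hC hA (τ ≪≫ₗ σ) = transport S hM hC hB τ ≪≫ₗ transport S hM hB hA σ := by
  refine LinearEquiv.ext fun y => ?_
  simp [transport]

theorem transport_smul (S : V ≃ₗ[K] V) {M B A M' B' A' : Submodule K V} (hM : img S M = M')
    (hB : img S B = B') (hA : img S A = A') (σ : DetIso M B A) (c : Kˣ) :
    transport S hM hB hA (σ ≪≫ₗ LinearEquiv.smulOfUnit c)
      = transport S hM hB hA σ ≪≫ₗ LinearEquiv.smulOfUnit c :=
  LinearEquiv.ext fun y => map_smul (lineMap S hA hM) (c : K) (σ ((lineMap S hB hM).symm y))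

theorem Commensurable.fin {A B C : Submodule K V} (h : Commensurable A C)
    (h' : Commensurable B C) : FiniteDimensional K (quo A B) :=
  (commensurable_iff.1 (h.trans h'.symm)).1

/-- The group `Gl(V)` of the pair `(V, V⁺)`: the linear automorphisms `S` of `V` such that `S(V⁺)`
and `S⁻¹(V⁺)` are commensurable with `V⁺`. -/
def Gl (Vp : Submodule K V) : Subgroup (V ≃ₗ[K] V) where
  carrier := {S | Commensurable (img S Vp) Vp ∧ Commensurable (img S⁻¹ Vp) Vp}
  one_mem' := ⟨Commensurable.refl _, Commensurable.refl _⟩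
  mul_mem' {S T} hS hT := ⟨(hT.1.img S).trans hS.1, by
    rw [mul_inv_rev]
    exact (hS.2.img T⁻¹).trans hT.2⟩
  inv_mem' {S} hS := ⟨hS.2, by rw [inv_inv]; exact hS.1⟩

/-- The group `Gl~(V)`, as a set: the pairs `(σ, S)` of `S ∈ Gl(V)` and an isomorphism
`σ : ∧(S(V⁺) / (S(V⁺) ∩ V⁺)) ≃ ∧(V⁺ / (S(V⁺) ∩ V⁺))`, that is, a generator of the line
`∧(V⁺ / (S(V⁺) ∩ V⁺)) ⊗ ∧(S(V⁺) / (S(V⁺) ∩ V⁺))^*` of isomorphisms from the determinant of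
`U → V / S(V⁺)` to the determinant of `U → V / V⁺`. -/
structure GlTilde (Vp : Submodule K V) where
  /-- The projection to `Gl(V)`. -/
  toGl : Gl Vp
  /-- The isomorphism of determinants. -/
  form : DetIso (img toGl.1 Vp ⊓ Vp) (img toGl.1 Vp) Vp

namespace GlTilde

variable {Vp : Submodule K V}

/-- `stab` for subspaces commensurable with `V⁺`. -/
noncomputable def stabC {P M B A : Submodule K V} (h : P ≤ M) (hB : M ≤ B) (hA : M ≤ A)
    (cP : Commensurable P Vp) (cB : Commensurable B Vp) (cA : Commensurable A Vp) :
    DetIso M B A ≃ DetIso P B A :=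
  have := cB.fin cP
  have := cA.fin cP
  have : FiniteDimensional K (quo M P) := quo_fin_of_le hB
  stab h hB hA

theorem isStab_stabC {P M B A : Submodule K V} (h : P ≤ M) (hB : M ≤ B) (hA : M ≤ A)
    (cP : Commensurable P Vp) (cB : Commensurable B Vp) (cA : Commensurable A Vp)
    (σ : DetIso M B A) : IsStab h σ (stabC h hB hA cP cB cA σ) :=
  have := cB.fin cP
  have := cA.fin cP
  have : FiniteDimensional K (quo M P) := quo_fin_of_le hB
  (isStab_iff h hB hA _ _).2 rfl

theorem IsStab.eq_stabC {P M B A : Submodule K V} {h : P ≤ M} (hB : M ≤ B) (hA : M ≤ A)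
    (cP : Commensurable P Vp) (cB : Commensurable B Vp) (cA : Commensurable A Vp)
    {σ : DetIso M B A} {σ' : DetIso P B A} (hs : IsStab h σ σ') :
    σ' = stabC h hB hA cP cB cA σ :=
  have := cB.fin cP
  have := cA.fin cP
  have : FiniteDimensional K (quo M P) := quo_fin_of_le hB
  (isStab_iff h hB hA _ _).1 hs

theorem comm_img (S : Gl Vp) : Commensurable (img S.1 Vp) Vp := S.2.1

theorem comm_img_img (S : Gl Vp) {A : Submodule K V} (h : Commensurable A Vp) :
    Commensurable (img S.1 A) Vp := (h.img S.1).trans S.2.1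

/-- The group law `(σ, S) (τ, T) = (σ ∘ S(τ), S T)`: the composite of
`S(τ) : ∧(ST(V⁺) / P) ≃ ∧(S(V⁺) / P)` and `σ : ∧(S(V⁺) / P) ≃ ∧(V⁺ / P)` for
`P = ST(V⁺) ∩ S(V⁺) ∩ V⁺`, brought back to `ST(V⁺) ∩ V⁺`. -/
noncomputable instance : Mul (GlTilde Vp) where
  mul g h :=
    { toGl := g.toGl * h.toGl
      form :=
        (stabC (P := img (g.toGl * h.toGl).1 Vp ⊓ img g.toGl.1 Vp ⊓ Vp)
          (M := img (g.toGl * h.toGl).1 Vp ⊓ Vp) (le_inf (inf_le_left.trans inf_le_left) inf_le_right)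
          inf_le_left inf_le_right (((comm_img _).inf (comm_img _)).inf (Commensurable.refl _))
          (comm_img _) (Commensurable.refl _)).symm
        ((stabC (P := img (g.toGl * h.toGl).1 Vp ⊓ img g.toGl.1 Vp ⊓ Vp)
          (M := img (g.toGl * h.toGl).1 Vp ⊓ img g.toGl.1 Vp)
          inf_le_left inf_le_left inf_le_right
          (((comm_img _).inf (comm_img _)).inf (Commensurable.refl _)) (comm_img _) (comm_img _)
          (transport g.toGl.1 rfl rfl rfl h.form)) ≪≫ₗ
        (stabC (P := img (g.toGl * h.toGl).1 Vp ⊓ img g.toGl.1 Vp ⊓ Vp)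
          (M := img g.toGl.1 Vp ⊓ Vp) (le_inf (inf_le_left.trans inf_le_right) inf_le_right)
          inf_le_left inf_le_right (((comm_img _).inf (comm_img _)).inf (Commensurable.refl _))
          (comm_img _) (Commensurable.refl _) g.form)) }

@[simp] theorem toGl_mul (g h : GlTilde Vp) : (g * h).toGl = g.toGl * h.toGl := rfl

theorem isStab_mul (g h : GlTilde Vp) {P : Submodule K V} (cP : Commensurable P Vp)
    (h1 : P ≤ img g.toGl.1 Vp ⊓ Vp)
    (h2 : P ≤ img (g.toGl * h.toGl).1 Vp ⊓ img g.toGl.1 Vp)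
    (h3 : P ≤ img (g.toGl * h.toGl).1 Vp ⊓ Vp)
    {γ : DetIso P (img g.toGl.1 Vp) Vp} (hγ : IsStab h1 g.form γ)
    {δ : DetIso P (img (g.toGl * h.toGl).1 Vp) (img g.toGl.1 Vp)}
    (hδ : IsStab h2 (transport g.toGl.1 rfl rfl rfl h.form) δ) :
    IsStab h3 (g * h).form (δ ≪≫ₗ γ) := by
  let P0 := img (g.toGl * h.toGl).1 Vp ⊓ img g.toGl.1 Vp ⊓ Vp
  have cP0 : Commensurable P0 Vp := ((comm_img _).inf (comm_img _)).inf (Commensurable.refl _)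
  have hP : P ≤ P0 := le_inf h2 (h3.trans inf_le_right)
  have l1 : P0 ≤ img (g.toGl * h.toGl).1 Vp ⊓ Vp :=
    le_inf (inf_le_left.trans inf_le_left) inf_le_right
  have l2 : P0 ≤ img (g.toGl * h.toGl).1 Vp ⊓ img g.toGl.1 Vp := inf_le_left
  have l3 : P0 ≤ img g.toGl.1 Vp ⊓ Vp := le_inf (inf_le_left.trans inf_le_right) inf_le_right
  let δ0 := stabC l2 inf_le_left inf_le_right cP0 (comm_img _) (comm_img _)
    (transport g.toGl.1 rfl rfl rfl h.form)
  let γ0 := stabC l3 inf_le_left inf_le_right cP0 (comm_img _) (Commensurable.refl _) g.form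
  have e : (g * h).form = (stabC l1 inf_le_left inf_le_right cP0 (comm_img _)
    (Commensurable.refl _)).symm (δ0 ≪≫ₗ γ0) := rfl
  have hst : IsStab l1 (g * h).form (δ0 ≪≫ₗ γ0) := by
    have := isStab_stabC l1 inf_le_left inf_le_right cP0 (comm_img _) (Commensurable.refl _)
      (g * h).form
    rw [e, Equiv.apply_symm_apply] at this
    rw [e]
    exact this
  have f1 : FiniteDimensional K (quo (img (g.toGl * h.toGl).1 Vp) P) := (comm_img _).fin cP
  have f2 : FiniteDimensional K (quo (img g.toGl.1 Vp) P) := (comm_img _).fin cP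
  have f3 : FiniteDimensional K (quo Vp P) := (Commensurable.refl _).fin cP
  have s1 : IsStab hP δ0 δ := IsStab.factor (h := l2) inf_le_left
    (isStab_stabC l2 inf_le_left inf_le_right cP0 (comm_img _) (comm_img _) _) hδ
  have s2 : IsStab hP γ0 γ := IsStab.factor (h := l3) inf_le_left
    (isStab_stabC l3 inf_le_left inf_le_right cP0 (comm_img _) (Commensurable.refl _) _) hγ
  exact IsStab.trans (h' := hP) (h := l1) inf_le_left inf_le_right hst (s2.comp s1)

theorem ext_stab {g h : GlTilde Vp} (e : g.toGl = h.toGl) {P : Submodule K V}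
    (cP : Commensurable P Vp) (h1 : P ≤ img g.toGl.1 Vp ⊓ Vp) (h2 : P ≤ img h.toGl.1 Vp ⊓ Vp)
    {γ : DetIso P (img g.toGl.1 Vp) Vp} {γ' : DetIso P (img h.toGl.1 Vp) Vp}
    (hγ : IsStab h1 g.form γ) (hγ' : IsStab h2 h.form γ')
    (heq : ∀ (x : line (img g.toGl.1 Vp) P) (x' : line (img h.toGl.1 Vp) P),
      (x : ExteriorAlgebra K (V ⧸ P)) = x' →
      (γ x : ExteriorAlgebra K (V ⧸ P)) = γ' x') : g = h := by
  obtain ⟨S, σ⟩ := g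
  obtain ⟨T, τ⟩ := h
  obtain rfl : S = T := e
  have a := IsStab.eq_stabC inf_le_left inf_le_right cP (comm_img _) (Commensurable.refl _) hγ
  have b := IsStab.eq_stabC inf_le_left inf_le_right cP (comm_img _) (Commensurable.refl _) hγ'
  have c : γ = γ' := LinearEquiv.ext fun x => Subtype.ext (heq x x rfl)
  rw [c, b] at a
  have := (stabC _ _ _ _ _ _).injective a
  exact congrArg (GlTilde.mk S) this.symm

theorem mul_assoc' (g h k : GlTilde Vp) : g * h * k = g * (h * k) := by
  set S := g.toGl with hS
  set T := h.toGl with hT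
  set U := k.toGl with hU
  let Q := img (S * T * U).1 Vp ⊓ img (S * T).1 Vp ⊓ img S.1 Vp ⊓ Vp
  let P1 := img (S⁻¹).1 Q
  let P := img S.1 P1
  have hPQ : P = Q := img_inv_img S.1 Q
  have cQ : Commensurable Q Vp :=
    (((comm_img _).inf (comm_img _)).inf (comm_img _)).inf (Commensurable.refl _)
  have cP : Commensurable P Vp := by rw [hPQ]; exact cQ
  have cP1 : Commensurable P1 Vp := comm_img_img _ cQ
  have l0 : P ≤ Vp := hPQ.le.trans inf_le_right
  have l1 : P ≤ img S.1 Vp := hPQ.le.trans (inf_le_left.trans inf_le_right)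
  have l2 : P ≤ img (S * T).1 Vp :=
    hPQ.le.trans (inf_le_left.trans (inf_le_left.trans inf_le_right))
  have l3 : P ≤ img (S * T * U).1 Vp :=
    hPQ.le.trans (inf_le_left.trans (inf_le_left.trans inf_le_left))
  have cancel : ∀ A : Submodule K V, P ≤ img S.1 A → P1 ≤ A := by
    intro A h v hv
    have := h (show S.1 v ∈ P from by
      change S.1.symm (S.1 v) ∈ P1
      rwa [LinearEquiv.symm_apply_apply])
    change S.1.symm (S.1 v) ∈ A at this
    rwa [LinearEquiv.symm_apply_apply] at this
  have m0 : P1 ≤ Vp := cancel _ l1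
  have m1 : P1 ≤ img T.1 Vp := cancel _ l2
  have m2 : P1 ≤ img (T * U).1 Vp := cancel _ l3
  let γ := stabC (le_inf l1 l0) inf_le_left inf_le_right cP (comm_img _) (Commensurable.refl _)
    g.form
  have hγ : IsStab (le_inf l1 l0) g.form γ := isStab_stabC _ _ _ _ _ _ _
  let η := stabC (le_inf m1 m0) inf_le_left inf_le_right cP1 (comm_img _) (Commensurable.refl _)
    h.form
  have hη : IsStab (le_inf m1 m0) h.form η := isStab_stabC _ _ _ _ _ _ _
  let κ := stabC (le_inf m2 m1) inf_le_left inf_le_right cP1 (comm_img (T * U)) (comm_img T)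
    (transport T.1 rfl rfl rfl k.form)
  have hκ : IsStab (le_inf m2 m1) (transport T.1 rfl rfl rfl k.form) κ :=
    isStab_stabC _ _ _ _ _ _ _
  have hhk : IsStab (le_inf m2 m0) (h * k).form (κ ≪≫ₗ η) :=
    isStab_mul h k cP1 (le_inf m1 m0) (le_inf m2 m1) (le_inf m2 m0) hη hκ
  let η' : DetIso P (img (S * T).1 Vp) (img S.1 Vp) := transport S.1 rfl rfl rfl η
  let κ' : DetIso P (img (S * T * U).1 Vp) (img (S * T).1 Vp) := transport S.1 rfl rfl rfl κ
  have f1 : FiniteDimensional K (quo (img T.1 Vp) P1) := (comm_img _).fin cP1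
  have f2 : FiniteDimensional K (quo (img (T * U).1 Vp) P1) := (comm_img _).fin cP1
  have hη' : IsStab (le_inf l2 l1) (transport S.1 rfl rfl rfl h.form) η' :=
    IsStab.transport S.1 (le_inf l2 l1) inf_le_left rfl rfl rfl rfl hη
  have hκ'' := IsStab.transport S.1 (le_inf l3 l2) inf_le_left rfl
    (rfl : img S.1 (img (T * U).1 Vp ⊓ img T.1 Vp) = img (S * T * U).1 Vp ⊓ img (S * T).1 Vp)
    (rfl : img S.1 (img (T * U).1 Vp) = img (S * T * U).1 Vp)
    (rfl : img S.1 (img T.1 Vp) = img (S * T).1 Vp) hκ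
  have hκ' : IsStab (le_inf l3 l2) (transport (g * h).toGl.1 rfl rfl rfl k.form) κ' := by
    have E : transport (S.1 * T.1) (rfl : img (S.1 * T.1) (img U.1 Vp ⊓ Vp)
        = img S.1 (img T.1 (img U.1 Vp ⊓ Vp)))
      (rfl : img (S.1 * T.1) (img U.1 Vp) = img S.1 (img T.1 (img U.1 Vp)))
      (rfl : img (S.1 * T.1) Vp = img S.1 (img T.1 Vp)) k.form
      = transport S.1 rfl rfl rfl (transport T.1 rfl rfl rfl k.form) :=
      transport_mul S.1 T.1 rfl rfl rfl rfl rfl rfl rfl rfl rfl k.form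
    exact (congrArg (fun z => IsStab (le_inf l3 l2) z κ') E).mpr hκ''
  have hgh : IsStab (le_inf l2 l0) (g * h).form (η' ≪≫ₗ γ) :=
    isStab_mul g h cP (le_inf l1 l0) (le_inf l2 l1) (le_inf l2 l0) hγ hη'
  have L : IsStab (le_inf l3 l0) (g * h * k).form (κ' ≪≫ₗ (η' ≪≫ₗ γ)) :=
    isStab_mul (g * h) k cP (le_inf l2 l0) (le_inf l3 l2) (le_inf l3 l0) hgh hκ'
  have hhk' : IsStab (le_inf l3 l1) (transport S.1 rfl rfl rfl (h * k).form) (κ' ≪≫ₗ η') := by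
    have := IsStab.transport S.1 (le_inf l3 l1) inf_le_left (rfl : img S.1 P1 = P)
      (rfl : img S.1 (img (T * U).1 Vp ⊓ Vp) = img (S * T * U).1 Vp ⊓ img S.1 Vp)
      (rfl : img S.1 (img (T * U).1 Vp) = img (S * T * U).1 Vp) rfl hhk
    rw [transport_comp S.1 (rfl : img S.1 P1 = P) rfl
      (rfl : img S.1 (img T.1 Vp) = img (S * T).1 Vp)] at this
    exact this
  have R : IsStab (le_inf l3 l0) (g * (h * k)).form ((κ' ≪≫ₗ η') ≪≫ₗ γ) :=
    isStab_mul g (h * k) cP (le_inf l1 l0) (le_inf l3 l1) (le_inf l3 l0) hγ hhk'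
  refine ext_stab (_root_.mul_assoc _ _ _) cP (le_inf l3 l0) (le_inf l3 l0) L R ?_
  intro x x' hx
  have hx : x = x' := Subtype.ext hx
  rw [← hx]
  rfl

/-- The pair `(c σ, S)`, for a pair `(σ, S)` and a nonzero scalar `c`. -/
noncomputable def scale (c : Kˣ) (g : GlTilde Vp) : GlTilde Vp :=
  ⟨g.toGl, g.form ≪≫ₗ LinearEquiv.smulOfUnit c⟩

/-- The pair `(id, 1)`. -/
noncomputable instance : One (GlTilde Vp) where
  one := ⟨1, LinearEquiv.ofEq _ _ (by rw [Subgroup.coe_one, img_one])⟩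

@[simp] theorem toGl_one : (1 : GlTilde Vp).toGl = 1 := rfl

theorem one_form_coe (x : line (img (1 : Gl Vp).1 Vp) (img (1 : Gl Vp).1 Vp ⊓ Vp)) :
    ((1 : GlTilde Vp).form x : ExteriorAlgebra K (V ⧸ (img (1 : Gl Vp).1 Vp ⊓ Vp))) = x := rfl

theorem scale_scale (a b : Kˣ) (g : GlTilde Vp) : scale a (scale b g) = scale (a * b) g := by
  refine congrArg (GlTilde.mk g.toGl) (LinearEquiv.ext fun x => ?_)
  exact smul_smul a b (g.form x)

theorem scale_one (g : GlTilde Vp) : scale 1 g = g := by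
  obtain ⟨S, σ⟩ := g
  refine congrArg (GlTilde.mk S) (LinearEquiv.ext fun x => ?_)
  exact one_smul Kˣ (σ x)

theorem isStab_scale (c : Kˣ) {P M B A : Submodule K V} {h : P ≤ M} {σ : DetIso M B A}
    {σ' : DetIso P B A} (hs : IsStab h σ σ') :
    IsStab h (σ ≪≫ₗ LinearEquiv.smulOfUnit c) (σ' ≪≫ₗ LinearEquiv.smulOfUnit c) := by
  intro μ hμ x y hy
  change (c : K) • (σ' y : ExteriorAlgebra K (V ⧸ P))
    = wedge _ μ ((c : K) • (σ x : ExteriorAlgebra K (V ⧸ M)))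
  rw [map_smul, hs μ hμ x y hy]

theorem isStab_refl {P M A : Submodule K V} (h : P ≤ M) :
    IsStab h (LinearEquiv.refl K (line A M)) (LinearEquiv.refl K (line A P)) :=
  fun _ _ _ _ hy => hy

theorem scale_mul (c : Kˣ) (g h : GlTilde Vp) : scale c g * h = scale c (g * h) := by
  let P := img (g.toGl * h.toGl).1 Vp ⊓ img g.toGl.1 Vp ⊓ Vp
  have cP : Commensurable P Vp := ((comm_img _).inf (comm_img _)).inf (Commensurable.refl _)
  have l1 : P ≤ img (g.toGl * h.toGl).1 Vp ⊓ Vp :=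
    le_inf (inf_le_left.trans inf_le_left) inf_le_right
  have l2 : P ≤ img (g.toGl * h.toGl).1 Vp ⊓ img g.toGl.1 Vp := inf_le_left
  have l3 : P ≤ img g.toGl.1 Vp ⊓ Vp := le_inf (inf_le_left.trans inf_le_right) inf_le_right
  have hδ := isStab_stabC l2 inf_le_left inf_le_right cP (comm_img _) (comm_img _)
    (transport g.toGl.1 rfl rfl rfl h.form)
  have hγ := isStab_stabC l3 inf_le_left inf_le_right cP (comm_img _) (Commensurable.refl _) g.form
  have L := isStab_mul (scale c g) h cP l3 l2 l1 (isStab_scale c hγ) hδ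
  have R := isStab_scale c (isStab_mul g h cP l3 l2 l1 hγ hδ)
  refine ext_stab (h := scale c (g * h)) rfl cP l1 l1 L R ?_
  intro x x' hx
  have hx : x = x' := Subtype.ext hx
  rw [← hx]
  rfl

theorem mul_scale (c : Kˣ) (g h : GlTilde Vp) : g * scale c h = scale c (g * h) := by
  let P := img (g.toGl * h.toGl).1 Vp ⊓ img g.toGl.1 Vp ⊓ Vp
  have cP : Commensurable P Vp := ((comm_img _).inf (comm_img _)).inf (Commensurable.refl _)
  have l1 : P ≤ img (g.toGl * h.toGl).1 Vp ⊓ Vp :=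
    le_inf (inf_le_left.trans inf_le_left) inf_le_right
  have l2 : P ≤ img (g.toGl * h.toGl).1 Vp ⊓ img g.toGl.1 Vp := inf_le_left
  have l3 : P ≤ img g.toGl.1 Vp ⊓ Vp := le_inf (inf_le_left.trans inf_le_right) inf_le_right
  have hδ := isStab_stabC l2 inf_le_left inf_le_right cP (comm_img _) (comm_img _)
    (transport g.toGl.1 rfl rfl rfl h.form)
  let γ := stabC l3 inf_le_left inf_le_right cP (comm_img _) (Commensurable.refl _) g.form
  have hγ : IsStab l3 g.form γ := isStab_stabC _ _ _ _ _ _ _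
  have E : transport g.toGl.1 rfl rfl rfl (scale c h).form
      = transport g.toGl.1 rfl rfl rfl h.form ≪≫ₗ LinearEquiv.smulOfUnit c :=
    transport_smul g.toGl.1 rfl rfl rfl h.form c
  have hδ' := (congrArg (fun z => IsStab l2 z (stabC l2 inf_le_left inf_le_right cP (comm_img _)
    (comm_img _) (transport g.toGl.1 rfl rfl rfl h.form) ≪≫ₗ LinearEquiv.smulOfUnit c)) E).mpr
    (isStab_scale c hδ)
  have L := isStab_mul g (scale c h) cP l3 l2 l1 hγ hδ'
  have R := isStab_scale c (isStab_mul g h cP l3 l2 l1 hγ hδ)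
  refine ext_stab (h := scale c (g * h)) rfl cP l1 l1 L R ?_
  intro x x' hx
  have hx : x = x' := Subtype.ext hx
  rw [← hx]
  refine congrArg Subtype.val (?_ : _ = (_ : line Vp P))
  exact map_smul γ (c : K) _

theorem one_mul' (g : GlTilde Vp) : 1 * g = g := by
  have cP : Commensurable (img g.toGl.1 Vp ⊓ Vp) Vp := (comm_img _).inf (Commensurable.refl _)
  let σ := stabC (le_refl (img g.toGl.1 Vp ⊓ Vp)) inf_le_left inf_le_right cP (comm_img _)
    (Commensurable.refl _) g.form
  have hσ : IsStab (le_refl (img g.toGl.1 Vp ⊓ Vp)) g.form σ := isStab_stabC _ _ _ _ _ _ _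
  have hγ : IsStab (le_inf inf_le_right inf_le_right :
      img g.toGl.1 Vp ⊓ Vp ≤ img (1 : Gl Vp).1 Vp ⊓ Vp) (1 : GlTilde Vp).form
      (LinearEquiv.refl K (line Vp (img g.toGl.1 Vp ⊓ Vp))) := isStab_refl _
  have E : transport (1 : V ≃ₗ[K] V) (rfl : img (1 : V ≃ₗ[K] V) (img g.toGl.1 Vp ⊓ Vp) = _)
    (rfl : img (1 : V ≃ₗ[K] V) (img g.toGl.1 Vp) = _)
    (rfl : img (1 : V ≃ₗ[K] V) Vp = _) g.form = g.form := transport_one rfl rfl rfl g.form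
  have hδ := (congrArg (fun z => IsStab (le_refl (img g.toGl.1 Vp ⊓ Vp)) z σ) E).mpr hσ
  have L := isStab_mul 1 g cP (le_inf inf_le_right inf_le_right) (le_refl _) (le_refl _) hγ hδ
  refine ext_stab (_root_.one_mul g.toGl) cP (le_refl _) (le_refl _) L hσ ?_
  intro x x' hx
  have hx : x = x' := Subtype.ext hx
  rw [← hx]
  rfl

/-- Every `S ∈ Gl(V)` lifts to `Gl~(V)`. -/
theorem toGl_surjective : Function.Surjective (toGl : GlTilde Vp → Gl Vp) := by
  intro S
  have cM : Commensurable (img S.1 Vp ⊓ Vp) Vp := (comm_img S).inf (Commensurable.refl _)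
  have f1 : FiniteDimensional K (quo (img S.1 Vp) (img S.1 Vp ⊓ Vp)) := (comm_img S).fin cM
  have f2 : FiniteDimensional K (quo Vp (img S.1 Vp ⊓ Vp)) := (Commensurable.refl _).fin cM
  have : FiniteDimensional K (line (img S.1 Vp) (img S.1 Vp ⊓ Vp)) := finite_pow _ _
  have : FiniteDimensional K (line Vp (img S.1 Vp ⊓ Vp)) := finite_pow _ _
  exact ⟨⟨S, LinearEquiv.ofFinrankEq _ _ (by rw [finrank_line, finrank_line])⟩, rfl⟩

/-- Two lifts of the same `S ∈ Gl(V)` differ by a nonzero scalar. -/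
theorem exists_scale {g h : GlTilde Vp} (e : g.toGl = h.toGl) : ∃ c : Kˣ, g = scale c h := by
  obtain ⟨S, σ⟩ := g
  obtain ⟨T, τ⟩ := h
  obtain rfl : S = T := e
  have cM : Commensurable (img S.1 Vp ⊓ Vp) Vp := (comm_img S).inf (Commensurable.refl _)
  have f1 : FiniteDimensional K (quo (img S.1 Vp) (img S.1 Vp ⊓ Vp)) := (comm_img S).fin cM
  have hr := finrank_line (img S.1 Vp) (img S.1 Vp ⊓ Vp)
  obtain ⟨x, hx, h0⟩ := exists_ne_zero (img S.1 Vp) (img S.1 Vp ⊓ Vp)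
  have hx0 : (⟨x, hx⟩ : line (img S.1 Vp) (img S.1 Vp ⊓ Vp)) ≠ 0 := by simpa using h0
  have h1 := (finrank_eq_one_iff_of_nonzero' _ hx0).1 hr
  obtain ⟨c, hc⟩ := h1 (τ.symm (σ ⟨x, hx⟩))
  have hc0 : c ≠ 0 := by
    rintro rfl
    rw [zero_smul] at hc
    have := hc.symm
    rw [LinearEquiv.map_eq_zero_iff, LinearEquiv.map_eq_zero_iff] at this
    exact hx0 this
  refine ⟨Units.mk0 c hc0, congrArg (GlTilde.mk S) (LinearEquiv.ext fun y => ?_)⟩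
  obtain ⟨d, rfl⟩ := h1 y
  have e1 : σ ⟨x, hx⟩ = c • τ ⟨x, hx⟩ := by
    rw [← map_smul, hc, LinearEquiv.apply_symm_apply]
  change σ _ = c • τ _
  rw [map_smul, map_smul, e1, smul_comm]

theorem exists_left_inv (g : GlTilde Vp) : ∃ h : GlTilde Vp, h * g = 1 := by
  obtain ⟨h, hh⟩ := toGl_surjective g.toGl⁻¹
  obtain ⟨c, hc⟩ := exists_scale (g := h * g) (h := 1) (by rw [toGl_mul, hh, inv_mul_cancel]; rfl)
  exact ⟨scale c⁻¹ h, by rw [scale_mul, hc, scale_scale, inv_mul_cancel, scale_one]⟩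

/-- The group `Gl~(V)`. -/
noncomputable instance : Group (GlTilde Vp) :=
  letI : Inv (GlTilde Vp) := ⟨fun g => (exists_left_inv g).choose⟩
  Group.ofLeftAxioms mul_assoc' one_mul' fun g => (exists_left_inv g).choose_spec

/-- The projection `Gl~(V) → Gl(V)`. -/
def proj : GlTilde Vp →* Gl Vp where
  toFun := toGl
  map_one' := rfl
  map_mul' _ _ := rfl

/-- The inclusion of the multiplicative group as the pairs `(c, 1)`. -/
noncomputable def scalar : Kˣ →* GlTilde Vp where
  toFun c := scale c 1
  map_one' := scale_one 1
  map_mul' a b := by rw [scale_mul, one_mul, scale_scale]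

theorem scalar_mul (c : Kˣ) (g : GlTilde Vp) : scalar c * g = scale c g := by
  change scale c 1 * g = _
  rw [scale_mul, one_mul]

/-- The extension is central. -/
theorem scalar_mul_comm (c : Kˣ) (g : GlTilde Vp) : scalar c * g = g * scalar c := by
  rw [scalar_mul]
  change _ = g * scale c 1
  rw [mul_scale, mul_one]

theorem proj_surjective : Function.Surjective (proj : GlTilde Vp →* Gl Vp) := toGl_surjective

/-- The extension is exact in the middle. -/
theorem range_scalar : (scalar : Kˣ →* GlTilde Vp).range = proj.ker := by
  ext g
  rw [MonoidHom.mem_range, MonoidHom.mem_ker]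
  constructor
  · rintro ⟨c, rfl⟩
    rfl
  · intro h
    obtain ⟨c, hc⟩ := exists_scale (g := g) (h := 1) h
    exact ⟨c, hc.symm⟩

theorem scalar_injective : Function.Injective (scalar : Kˣ →* GlTilde Vp) := by
  rw [injective_iff_map_eq_one]
  intro c hc
  have cM : Commensurable (img (1 : Gl Vp).1 Vp ⊓ Vp) Vp := (comm_img 1).inf (Commensurable.refl _)
  have f1 : FiniteDimensional K (quo Vp (img (1 : Gl Vp).1 Vp ⊓ Vp)) :=
    (Commensurable.refl _).fin cM
  obtain ⟨x, hx, h0⟩ := exists_ne_zero Vp (img (1 : Gl Vp).1 Vp ⊓ Vp)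
  have key : scale c (1 : GlTilde Vp) = ⟨1, (1 : GlTilde Vp).form⟩ := hc
  rw [scale, GlTilde.mk.injEq] at key
  have h2 := eq_of_heq key.2
  have h3 : (c : K) • x = x := congrArg Subtype.val (LinearEquiv.congr_fun h2 ⟨x, hx⟩)
  apply Units.ext
  have h4 : ((c : K) - 1) • x = 0 := by rw [sub_smul, h3, one_smul, sub_self]
  rcases smul_eq_zero.1 h4 with h | h
  · exact sub_eq_zero.1 h
  · exact absurd h h0

end GlTilde
end

section
variable (k : Type*) [Field k] (k' : Type*) [CommRing k'] [Algebra k k']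

/-- `k'[[z]]`, as a `k`-subspace of `k'((z))`: the series without terms of negative degree. -/
def powerSeriesLattice : Submodule k (LaurentSeries k') where
  carrier := {f | ∀ n < 0, f.coeff n = 0}
  zero_mem' _ _ := rfl
  add_mem' {f g} hf hg n hn := by rw [HahnSeries.coeff_add, hf n hn, hg n hn, add_zero]
  smul_mem' c f hf n hn := by rw [HahnSeries.coeff_smul, hf n hn, smul_zero]

variable {k'}

variable {k} in
theorem mul_smul_coeff (c : k) (a b : LaurentSeries k') : a * (c • b) = c • (a * b) := by
  have h : ∀ x : LaurentSeries k', c • x = HahnSeries.C (algebraMap k k' c) * x := by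
    intro x
    rw [HahnSeries.C_mul_eq_smul]
    ext n
    rw [HahnSeries.coeff_smul, HahnSeries.coeff_smul, algebraMap_smul]
  rw [h, h, mul_left_comm]

/-- The homothety `f ↦ S f` of `k'((z))`. -/
noncomputable def mulEquiv (S : (LaurentSeries k')ˣ) : LaurentSeries k' ≃ₗ[k] LaurentSeries k' where
  toFun f := S * f
  invFun f := (S⁻¹ : (LaurentSeries k')ˣ) * f
  map_add' f g := mul_add _ f g
  map_smul' c f := mul_smul_coeff c _ f
  left_inv f := by simp
  right_inv f := by simp

theorem fin_quo_mulEquiv [Module.Finite k k'] (S : (LaurentSeries k')ˣ) :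
    FiniteDimensional k
      (quo (img (mulEquiv k S) (powerSeriesLattice k k')) (powerSeriesLattice k k')) := by
  obtain ⟨n, hn⟩ : ∃ n : ℕ, ∀ m : ℤ, m < -n → (S : LaurentSeries k').coeff m = 0 := by
    refine ⟨(S : LaurentSeries k').order.natAbs, fun m hm => ?_⟩
    apply HahnSeries.coeff_eq_zero_of_lt_order
    omega
  let f : LaurentSeries k' →ₗ[k] (Fin n → k') :=
    LinearMap.pi fun i =>
      { toFun := fun x => x.coeff (-((i : ℕ) : ℤ) - 1)
        map_add' := fun _ _ => HahnSeries.coeff_add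
        map_smul' := fun _ _ => rfl }
  have hf : powerSeriesLattice k k' ≤ LinearMap.ker f := by
    intro x hx
    ext i
    exact hx _ (by omega)
  let g := (powerSeriesLattice k k').liftQ f hf
  apply FiniteDimensional.of_injective
    (g.domRestrict (quo (img (mulEquiv k S) (powerSeriesLattice k k')) (powerSeriesLattice k k')))
  rw [← LinearMap.ker_eq_bot, eq_bot_iff]
  rintro ⟨_, v, hv, rfl⟩ h
  rw [Submodule.mem_bot]
  apply Subtype.ext
  refine (Submodule.Quotient.mk_eq_zero _).2 ?_
  have h : f v = 0 := h
  have hv : (S⁻¹ : (LaurentSeries k')ˣ) * v ∈ powerSeriesLattice k k' := hv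
  intro m hm
  rcases lt_or_ge m (-n : ℤ) with h1 | h1
  · have e : v = S * ((S⁻¹ : (LaurentSeries k')ˣ) * v) := by simp
    rw [e, HahnSeries.coeff_mul]
    refine Finset.sum_eq_zero fun ij hij => ?_
    rw [Finset.mem_antidiagonal] at hij
    rcases lt_or_ge ij.2 0 with h2 | h2
    · rw [hv _ h2, mul_zero]
    · rw [hn ij.1 (by omega), zero_mul]
  · have := congrFun h ⟨(-m - 1).toNat, by omega⟩
    change v.coeff (-(((-m - 1).toNat : ℕ) : ℤ) - 1) = 0 at this
    rwa [show (-(((-m - 1).toNat : ℕ) : ℤ) - 1) = m by omega] at this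

theorem commensurable_mulEquiv [Module.Finite k k'] (S : (LaurentSeries k')ˣ) :
    Commensurable (img (mulEquiv k S) (powerSeriesLattice k k')) (powerSeriesLattice k k') := by
  rw [commensurable_iff]
  refine ⟨fin_quo_mulEquiv k S, ?_⟩
  have := fin_img (mulEquiv k S) (fin_quo_mulEquiv k S⁻¹)
  have e : img (mulEquiv k S) (img (mulEquiv k S⁻¹) (powerSeriesLattice k k'))
      = powerSeriesLattice k k' :=
    img_inv_img (mulEquiv k S) _
  rwa [e] at this

/-- The embedding of `G = k'((z))^*` in `Gl(V)`, for `V = k'((z))` and `V⁺ = k'[[z]]`. -/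
noncomputable def homothety [Module.Finite k k'] : (LaurentSeries k')ˣ →* Gl (powerSeriesLattice k k') where
  toFun S := ⟨mulEquiv k S, commensurable_mulEquiv k S, commensurable_mulEquiv k S⁻¹⟩
  map_one' := Subtype.ext (LinearEquiv.ext fun f => one_mul f)
  map_mul' S T := Subtype.ext (LinearEquiv.ext fun f => mul_assoc (S : LaurentSeries k') T f)

/-- The image of a series in `(k' / N)((z))`, where `N` is the nilradical of `k'`. -/
noncomputable def reduction (f : LaurentSeries k') : LaurentSeries (k' ⧸ nilradical k') :=
  HahnSeries.map f (Ideal.Quotient.mk (nilradical k'))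

/-- The valuation `ν` on `k'((z))^*`: the `z`-adic valuation of the reduction modulo the nilradical
(which is `0` if `k'` is a field). -/
noncomputable def val (S : (LaurentSeries k')ˣ) : ℤ :=
  (reduction (S : LaurentSeries k')).order

/-- The reduction of `S` modulo the nilradical is a power of `z` times an invertible power series:
its leading coefficient is a unit. -/
def HasUnitLeadingCoeff (S : (LaurentSeries k')ˣ) : Prop :=
  IsUnit (reduction (S : LaurentSeries k')).leadingCoeff

end

end DetExt

/-! The extension is central and `G` is commutative, so the commutator of lifts does not depend on
the lifts and is multiplicative in each argument. A unit with unit leading coefficient factors as `S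
= z ^ a * u * M`, where `a = ν(S)`, `u` is an invertible power series and `M - 1` is nilpotent with
nilpotent coefficients (`exists_decomposition`). It therefore suffices to know the commutators of
the three kinds of factors.

If `S` preserves `V⁺` and commutes with `T`, put `P = T(V⁺) ∩ V⁺`. The commutator is the determinant
of `S` on `V⁺ / P` divided by its determinant on `T(V⁺) / P` (`commutesUpTo_of_img_eq`). For two
power series `u`, `v` both quotients vanish and the commutator is `1`. For `u` and `z` the quotient
`V⁺ / zV⁺ = k'` carries multiplication by `u(0)`, which gives `Norm(u(0))`. The pair `z`, `z` gives
`1`.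

A unipotent `M` need not preserve `V⁺`, but it preserves some `L ⊇ V⁺` with `L / V⁺` finite
dimensional. As `V⁺` and `V / V⁺` are infinite dimensional when `k' ≠ 0`, some `α ∈ Gl(V)` maps `V⁺`
onto `L`. Conjugating by `α` reduces to the case `M(V⁺) = V⁺`, where both determinants are `1`
because `M` is unipotent (`commutesUpTo_one_of_isNilpotent`). The element `α` is in general not a
homothety, so this argument takes place in `Gl(V)` and not in `G`.

For `S = z ^ a * u * M` and `T = z ^ b * v * N` the commutator is thus `Norm(u(0) ^ b / v(0) ^ a)`.
In `S ^ b / T ^ a` the powers of `z` cancel, and `M`, `N` are `1` modulo series with nilpotent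
coefficients, so its constant coefficient differs from `u(0) ^ b / v(0) ^ a` by a nilpotent, which
does not affect the norm. -/

namespace DetExt

/-! ### Determinants and the action on top exterior powers -/

section
variable {K : Type*} [Field K] {W : Type*} [AddCommGroup W] [Module K W]

/-- The characteristic polynomial of the nilpotent `1 - f` is a power of `X`; its value at `1` is
`det (1 - (1 - f)) = det f`. -/
theorem det_eq_one_of_isNilpotent_sub_one [FiniteDimensional K W] {f : End K W}
    (h : IsNilpotent (f - 1)) : LinearMap.det f = 1 := by
  have h' : IsNilpotent (1 - f) := by rw [← neg_sub]; exact h.neg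
  have e := LinearMap.eval_charpoly (1 - f) (1 : K)
  rw [IsNilpotent.charpoly_eq_X_pow_finrank h', Polynomial.eval_pow, Polynomial.eval_X,
    one_pow, map_one, sub_sub_cancel] at e
  exact e.symm

theorem norm_eq_one_of_isNilpotent_sub_one {A : Type*} [CommRing A] [Algebra K A]
    [Module.Finite K A] {a : A} (h : IsNilpotent (a - 1)) : Algebra.norm K a = 1 := by
  rw [Algebra.norm_apply]
  apply det_eq_one_of_isNilpotent_sub_one
  rw [← map_one (Algebra.lmul K A)]
  change IsNilpotent (Algebra.lmul K A a - Algebra.lmul K A 1)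
  rw [← map_sub]
  exact h.map _

/-- The top exterior power is one-dimensional, so after an identification with `K` the map `ιMulti`
is a scalar-valued alternating form of maximal degree. Such a form is a multiple of the determinant
in a basis, for which the claim is the multiplicativity of `det`. -/
theorem ιMulti_comp_eq_det_smul [FiniteDimensional K W] (f : End K W) (v : Fin (finrank K W) → W) :
    ExteriorAlgebra.ιMulti K _ (f ∘ v) = LinearMap.det f • ExteriorAlgebra.ιMulti K _ v := by
  have hr : finrank K (⋀[K]^(finrank K W) W) = finrank K K := by
    rw [exteriorPower.finrank_eq, Nat.choose_self, finrank_self]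
  let ψ := LinearEquiv.ofFinrankEq _ _ hr
  let X := (ψ : _ →ₗ[K] K).compAlternatingMap (exteriorPower.ιMulti K (finrank K W) (M := W))
  have key : X (f ∘ v) = LinearMap.det f • X v := by
    rw [AlternatingMap.eq_smul_basis_det (finBasis K W) X, AlternatingMap.smul_apply,
      AlternatingMap.smul_apply, Basis.det_comp, smul_eq_mul, smul_eq_mul, smul_eq_mul]
    ring
  have key' : exteriorPower.ιMulti K (finrank K W) (f ∘ v)
      = LinearMap.det f • exteriorPower.ιMulti K (finrank K W) v := by
    apply ψ.injective
    rw [map_smul]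
    exact key
  exact congrArg Subtype.val key'

/-- An endomorphism acts on the top exterior power of a stable subspace by its determinant. -/
theorem map_eq_det_smul {X : Submodule K W} [FiniteDimensional K X] (g : W →ₗ[K] W) (f : End K X)
    (h : ∀ x : X, (f x : W) = g x) {y : ExteriorAlgebra K W}
    (hy : y ∈ (X.map (ExteriorAlgebra.ι K)) ^ finrank K X) :
    ExteriorAlgebra.map g y = LinearMap.det f • y := by
  rw [map_pow_eq] at hy
  obtain ⟨y, hy, rfl⟩ := hy
  rw [← ExteriorAlgebra.ιMulti_span_fixedDegree] at hy
  have c : g ∘ₗ X.subtype = X.subtype ∘ₗ f := LinearMap.ext fun x => (h x).symm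
  change ExteriorAlgebra.map g (ExteriorAlgebra.map X.subtype y)
    = LinearMap.det f • (ExteriorAlgebra.map X.subtype) y
  rw [← AlgHom.comp_apply, ExteriorAlgebra.map_comp_map, c, ← ExteriorAlgebra.map_comp_map,
    AlgHom.comp_apply, ← map_smul]
  congr 1
  induction hy using Submodule.span_induction with
  | mem x hx =>
    obtain ⟨v, rfl⟩ := hx
    rw [ExteriorAlgebra.map_apply_ιMulti, ιMulti_comp_eq_det_smul]
  | zero => simp
  | add x y _ _ hx hy => rw [map_add, hx, hy, smul_add]
  | smul a x _ hx => rw [map_smul, hx, smul_comm]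

end

section
variable {K : Type*} [Field K] {V : Type*} [AddCommGroup V] [Module K V]

/-- The endomorphism of `A / M` induced by an automorphism `S` that preserves `A` and `M`. -/
noncomputable def quoEnd (S : V ≃ₗ[K] V) {A M : Submodule K V} (hA : img S A = A)
    (hM : img S M = M) : End K (quo A M) :=
  (quoMap S hM : (V ⧸ M) →ₗ[K] _).restrict fun x hx => by
    rw [← map_quoMap_quo S hA hM]
    exact ⟨x, hx, rfl⟩

theorem extMap_eq_det_smul (S : V ≃ₗ[K] V) {A M : Submodule K V} (hA : img S A = A)
    (hM : img S M = M) [FiniteDimensional K (quo A M)] {x : ExteriorAlgebra K (V ⧸ M)}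
    (hx : x ∈ line A M) : extMap S hM x = LinearMap.det (quoEnd S hA hM) • x :=
  map_eq_det_smul _ (quoEnd S hA hM) (fun _ => rfl) hx

theorem isNilpotent_quoEnd_sub_one (S : V ≃ₗ[K] V) {A M : Submodule K V} (hA : img S A = A)
    (hM : img S M = M) (h : IsNilpotent ((S : End K V) - 1)) :
    IsNilpotent (quoEnd S hA hM - 1) := by
  obtain ⟨r, hr⟩ := h
  -- Powers of `quoEnd S hA hM - 1` are induced by powers of `S - 1`. The representative `v` is
  -- universally quantified because it changes in the induction.
  have key : ∀ (n : ℕ) (v : V) (x : quo A M), (x : V ⧸ M) = M.mkQ v →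
      (((quoEnd S hA hM - 1) ^ n) x : V ⧸ M) = M.mkQ ((((S : End K V) - 1) ^ n) v) := by
    intro n
    induction n with
    | zero => intro v x hx; exact hx
    | succ n ih =>
      intro v x hx
      rw [pow_succ, pow_succ, Module.End.mul_apply, Module.End.mul_apply]
      apply ih
      change quoMap S hM (x : V ⧸ M) - (x : V ⧸ M) = M.mkQ (S v - v)
      rw [hx, quoMap_mkQ, map_sub]
  refine ⟨r, LinearMap.ext fun x => Subtype.ext ?_⟩
  obtain ⟨v, hv⟩ := Submodule.mkQ_surjective _ (x : V ⧸ M)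
  rw [key r v x hv.symm, hr]
  simp

theorem extMap_eq_self (S : V ≃ₗ[K] V) {A M : Submodule K V} (hA : img S A = A)
    (hM : img S M = M) [FiniteDimensional K (quo A M)] (h : IsNilpotent ((S : End K V) - 1))
    {x : ExteriorAlgebra K (V ⧸ M)} (hx : x ∈ line A M) : extMap S hM x = x := by
  rw [extMap_eq_det_smul S hA hM hx,
    det_eq_one_of_isNilpotent_sub_one (isNilpotent_quoEnd_sub_one S hA hM h), one_smul]

end

/-! ### Commutators of lifts of commuting elements of `Gl(V)` -/

namespace GlTilde
section
variable {K : Type*} [Field K] {V : Type*} [AddCommGroup V] [Module K V] {Vp : Submodule K V}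

/-- The elements `S`, `T` of `Gl(V)` have lifts `S'`, `T'` with `S' T' = c T' S'`. -/
def CommutesUpTo (S T : Gl Vp) (c : Kˣ) : Prop :=
  ∃ S' T' : GlTilde Vp, proj S' = S ∧ proj T' = T ∧ S' * T' = scalar c * (T' * S')

theorem exists_scalar_mul {g h : GlTilde Vp} (e : proj g = proj h) :
    ∃ c : Kˣ, g = scalar c * h := by
  obtain ⟨c, hc⟩ := exists_scale e
  exact ⟨c, by rw [scalar_mul, hc]⟩

/-- Other lifts differ by central scalars, and these occur equally on both sides. Hence the constant
can be computed with any convenient lifts. -/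
theorem CommutesUpTo.mul_eq {S T : Gl Vp} {c : Kˣ} (h : CommutesUpTo S T c) {S' T' : GlTilde Vp}
    (hS : proj S' = S) (hT : proj T' = T) : S' * T' = scalar c * (T' * S') := by
  obtain ⟨S₀, T₀, rfl, rfl, e⟩ := h
  obtain ⟨a, rfl⟩ := exists_scalar_mul hS
  obtain ⟨b, rfl⟩ := exists_scalar_mul hT
  calc scalar a * S₀ * (scalar b * T₀) = scalar a * (S₀ * scalar b) * T₀ := by group
    _ = scalar a * scalar b * (S₀ * T₀) := by rw [← scalar_mul_comm]; group
    _ = scalar a * scalar b * scalar c * (T₀ * S₀) := by rw [e]; group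
    _ = scalar c * scalar b * (scalar a * T₀) * S₀ := by
      rw [← map_mul, ← map_mul, show a * b * c = c * b * a by rw [mul_comm a b, mul_comm _ c,
        mul_assoc], map_mul, map_mul]; group
    _ = scalar c * (scalar b * T₀ * (scalar a * S₀)) := by rw [scalar_mul_comm a T₀]; group

/-- Moving `T'` past `S₁' * S₂'` produces one central scalar for each factor. This, with
`CommutesUpTo.symm`, is the bimultiplicativity of the commutator. -/
theorem CommutesUpTo.mul_left {S₁ S₂ T : Gl Vp} {a b : Kˣ} (h₁ : CommutesUpTo S₁ T a)
    (h₂ : CommutesUpTo S₂ T b) : CommutesUpTo (S₁ * S₂) T (a * b) := by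
  obtain ⟨S₁', hS₁⟩ := proj_surjective S₁
  obtain ⟨S₂', T', hS₂, hT, e₂⟩ := h₂
  have e₁ := h₁.mul_eq hS₁ hT
  refine ⟨S₁' * S₂', T', by rw [map_mul, hS₁, hS₂], hT, ?_⟩
  calc S₁' * S₂' * T' = S₁' * scalar b * (T' * S₂') := by rw [mul_assoc, e₂]; group
    _ = scalar b * (S₁' * T') * S₂' := by rw [← scalar_mul_comm]; group
    _ = scalar b * scalar a * (T' * (S₁' * S₂')) := by rw [e₁]; group
    _ = _ := by rw [← map_mul, mul_comm b]

theorem CommutesUpTo.symm {S T : Gl Vp} {c : Kˣ} (h : CommutesUpTo S T c) :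
    CommutesUpTo T S c⁻¹ := by
  obtain ⟨S', T', hS, hT, e⟩ := h
  exact ⟨T', S', hT, hS, by rw [e, map_inv, inv_mul_cancel_left]⟩

theorem CommutesUpTo.mul_right {S T₁ T₂ : Gl Vp} {a b : Kˣ} (h₁ : CommutesUpTo S T₁ a)
    (h₂ : CommutesUpTo S T₂ b) : CommutesUpTo S (T₁ * T₂) (a * b) := by
  have := (h₁.symm.mul_left h₂.symm).symm
  rwa [← mul_inv, inv_inv] at this

theorem CommutesUpTo.one_left (T : Gl Vp) : CommutesUpTo 1 T 1 := by
  obtain ⟨T', hT⟩ := proj_surjective T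
  exact ⟨1, T', map_one _, hT, by simp⟩

theorem CommutesUpTo.refl (T : Gl Vp) : CommutesUpTo T T 1 := by
  obtain ⟨T', hT⟩ := proj_surjective T
  exact ⟨T', T', hT, hT, by simp⟩

theorem CommutesUpTo.inv_left {S T : Gl Vp} {c : Kˣ} (h : CommutesUpTo S T c) :
    CommutesUpTo S⁻¹ T c⁻¹ := by
  obtain ⟨S', T', hS, hT, e⟩ := h
  refine ⟨S'⁻¹, T', by rw [map_inv, hS], hT, ?_⟩
  rw [eq_comm, map_inv, inv_mul_eq_iff_eq_mul, ← mul_assoc, scalar_mul_comm, mul_assoc,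
    eq_inv_mul_iff_mul_eq, ← mul_assoc, e, ← mul_assoc, mul_inv_cancel_right]

theorem CommutesUpTo.zpow_left {S T : Gl Vp} {c : Kˣ} (h : CommutesUpTo S T c) (n : ℤ) :
    CommutesUpTo (S ^ n) T (c ^ n) := by
  have key : ∀ m : ℕ, CommutesUpTo (S ^ m) T (c ^ m) := by
    intro m
    induction m with
    | zero => simpa using CommutesUpTo.one_left T
    | succ m ih => rw [pow_succ, pow_succ]; exact ih.mul_left h
  obtain ⟨m, rfl | rfl⟩ := n.eq_nat_or_neg
  · simpa using key m
  · simpa using (key m).inv_left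

theorem CommutesUpTo.zpow_right {S T : Gl Vp} {c : Kˣ} (h : CommutesUpTo S T c) (n : ℤ) :
    CommutesUpTo S (T ^ n) (c ^ n) := by
  simpa using (h.symm.zpow_left n).symm

/-- Conjugation by a lift of `α` fixes the central scalars. The element `α` is arbitrary in `Gl(V)`,
so a subspace stable under `S` can be moved to `V⁺`. -/
theorem CommutesUpTo.of_conj {S T α : Gl Vp} {c : Kˣ}
    (h : CommutesUpTo (α⁻¹ * S * α) (α⁻¹ * T * α) c) : CommutesUpTo S T c := by
  obtain ⟨S', T', hS, hT, e⟩ := h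
  obtain ⟨A, rfl⟩ := proj_surjective α
  refine ⟨A * S' * A⁻¹, A * T' * A⁻¹, by simp [hS, mul_assoc], by simp [hT, mul_assoc], ?_⟩
  calc A * S' * A⁻¹ * (A * T' * A⁻¹) = A * (S' * T') * A⁻¹ := by group
    _ = A * scalar c * (T' * S') * A⁻¹ := by rw [e]; group
    _ = _ := by rw [← scalar_mul_comm]; group

/-- If `S` preserves `V⁺`, then commutators with `S` are determinants. -/
theorem commutesUpTo_of_img_eq {S T : Gl Vp} (hST : S * T = T * S) (hS : img S.1 Vp = Vp)
    (hM : img S.1 (img T.1 Vp ⊓ Vp) = img T.1 Vp ⊓ Vp) {a b : Kˣ}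
    (ha : ∀ x ∈ line Vp (img T.1 Vp ⊓ Vp), extMap S.1 hM x = (a : K) • x)
    (hb : ∀ x ∈ line (img T.1 Vp) (img T.1 Vp ⊓ Vp), extMap S.1 hM x = (b : K) • x) :
    CommutesUpTo S T (a / b) := by
  obtain ⟨h, hh⟩ := proj_surjective T
  obtain rfl : h.toGl = T := hh
  set P := img h.toGl.1 Vp ⊓ Vp with hP
  have cP : Commensurable P Vp := (comm_img _).inf (Commensurable.refl _)
  -- Since `S(V⁺) = V⁺`, source and target of the required isomorphism coincide, and the identity
  -- gives a lift of `S`.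
  let g : GlTilde Vp := ⟨S, LinearEquiv.ofEq _ _ (by rw [hS])⟩
  have hSTV : img (S * h.toGl).1 Vp = img h.toGl.1 Vp := by
    rw [hST]
    change img h.toGl.1 (img S.1 Vp) = _
    rw [hS]
  have hTSV : img (h.toGl * S).1 Vp = img h.toGl.1 Vp := by rw [← hST, hSTV]
  have l1 : P ≤ img S.1 Vp ⊓ Vp := by rw [hS, inf_idem]; exact inf_le_right
  have l2 : P ≤ img (S * h.toGl).1 Vp ⊓ img S.1 Vp := hM.ge
  have l3 : P ≤ img (S * h.toGl).1 Vp ⊓ Vp := by rw [hSTV]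
  have m2 : P ≤ img (h.toGl * S).1 Vp ⊓ img h.toGl.1 Vp := by
    rw [hTSV, inf_idem]; exact inf_le_left
  have m3 : P ≤ img (h.toGl * S).1 Vp ⊓ Vp := by rw [hTSV]
  have f1 : FiniteDimensional K (quo (img h.toGl.1 Vp) P) := (comm_img _).fin cP
  let η : DetIso P (img h.toGl.1 Vp) Vp := stabC (le_refl P) inf_le_left inf_le_right cP
    (comm_img _) (Commensurable.refl _) h.form
  have hη : IsStab (le_refl P) h.form η := isStab_stabC _ _ _ _ _ _ _
  let γ : DetIso P (img S.1 Vp) Vp := LinearEquiv.ofEq _ _ (by rw [hS])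
  have hγ : IsStab l1 g.form γ := fun μ hμ x y hy => hy
  -- At level `P`, which `S` preserves, the product `g * h` is represented by the conjugate `S ∘ η ∘
  -- S⁻¹`.
  let δ : DetIso P (img (S * h.toGl).1 Vp) (img S.1 Vp) := transport S.1 hM rfl rfl η
  have hδ : IsStab l2 (transport S.1 rfl rfl rfl h.form) δ :=
    IsStab.transport S.1 l2 inf_le_left hM rfl rfl rfl hη
  -- The transport of an identity is an identity, so `h * g` is represented by `η` itself.
  let δ' : DetIso P (img (h.toGl * S).1 Vp) (img h.toGl.1 Vp) := LinearEquiv.ofEq _ _ (by rw [hTSV])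
  have hδ' : IsStab m2 (transport h.toGl.1 rfl rfl rfl g.form) δ' := by
    intro μ hμ x y hy
    change (y : ExteriorAlgebra K (V ⧸ P)) = _
    rw [hy]
    obtain ⟨x, rfl⟩ := (lineMap h.toGl.1 (rfl : img h.toGl.1 (img S.1 Vp) = img (h.toGl * S).1 Vp)
      (rfl : img h.toGl.1 (img S.1 Vp ⊓ Vp) = img h.toGl.1 (img S.1 Vp ⊓ Vp))).surjective x
    refine congrArg (wedge m2 μ) ?_
    exact (congrArg Subtype.val (transport_apply h.toGl.1 rfl rfl rfl g.form x)).symm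
  have L : IsStab l3 (g * h).form (δ ≪≫ₗ γ) := isStab_mul g h cP l1 l2 l3 hγ hδ
  have R : IsStab m3 (h * g).form (δ' ≪≫ₗ η) := isStab_mul h g cP le_rfl m2 m3 hη hδ'
  refine ⟨g, h, rfl, rfl, ?_⟩
  rw [scalar_mul]
  refine ext_stab (h := scale (a / b) (h * g)) hST cP l3 m3 L (isStab_scale (a / b) R) ?_
  intro y y' hy
  obtain ⟨x, rfl⟩ := (lineMap S.1
      (rfl : img S.1 (img h.toGl.1 Vp) = img (S * h.toGl).1 Vp) hM).surjective y
  -- With `y = S(x)`, one side is `S(η x) = a • η x`, and the other is `η (b • x) = b • η x`; the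
  -- ratio is `a / b`.
  have h1 : (δ' y' : line (img h.toGl.1 Vp) P) = (b : K) • x := by
    apply Subtype.ext
    change (y' : ExteriorAlgebra K (V ⧸ P)) = _
    rw [← hy, lineMap_coe, hb _ x.2]
    rfl
  have h2 : ((δ (lineMap S.1
      (rfl : img S.1 (img h.toGl.1 Vp) = img (S * h.toGl).1 Vp) hM x) : line (img S.1 Vp) P) :
      ExteriorAlgebra K (V ⧸ P)) = (a : K) • (η x : ExteriorAlgebra K (V ⧸ P)) := by
    change ((transport S.1 hM rfl rfl η (lineMap S.1 rfl hM x) : line (img S.1 Vp) P) :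
      ExteriorAlgebra K (V ⧸ P)) = _
    rw [transport_apply, lineMap_coe, ha _ (η x).2]
  refine h2.trans ?_
  change _ = (((a / b : Kˣ) : K)) • ((η (δ' y') : line Vp P) : ExteriorAlgebra K (V ⧸ P))
  rw [h1, map_smul, Submodule.coe_smul, smul_smul, Units.val_div_eq_div_val,
    div_mul_cancel₀ _ b.ne_zero]

end
end GlTilde
end DetExt

/-! ### Unipotent elements have trivial commutators -/

namespace DetExt

section
variable {K : Type*} [Field K] {V : Type*} [AddCommGroup V] [Module K V]

/-- A unipotent automorphism stabilises a subspace that contains `A` with finite codimension. -/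
theorem exists_img_eq_self (S : V ≃ₗ[K] V) (A : Submodule K V)
    (hA : FiniteDimensional K (quo (img S A) A)) (h : IsNilpotent ((S : End K V) - 1)) :
    ∃ L, A ≤ L ∧ FiniteDimensional K (quo L A) ∧ img S L = L := by
  obtain ⟨r, hr⟩ := h
  set f : End K V := (S : End K V) - 1 with hf
  have hfS : ∀ v, f v = S v - v := fun v => rfl
  -- As `f = S - 1`, one has `f(X) ⊆ S(X) + X`. The space `S(X)` is finite over `S(A)`, which is
  -- finite over `A`.
  have fin_map : ∀ X : Submodule K V, FiniteDimensional K (quo X A) →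
      FiniteDimensional K (quo (X.map f) A) := by
    intro X hX
    have h1 : X.map f ≤ img S X ⊔ X := by
      rintro _ ⟨v, hv, rfl⟩
      rw [hfS]
      refine Submodule.sub_mem _ (Submodule.mem_sup_left ?_) (Submodule.mem_sup_right hv)
      rw [← map_eq_img]
      exact ⟨v, hv, rfl⟩
    have := fin_sup (fin_trans (fin_img S hX) hA) hX
    exact Submodule.finiteDimensional_of_le
      (show quo (X.map f) A ≤ quo (img S X ⊔ X) A from Submodule.map_mono h1)
  have fin_pow : ∀ j : ℕ, FiniteDimensional K (quo (A.map (f ^ j)) A) := by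
    intro j
    induction j with
    | zero => rw [pow_zero, Module.End.one_eq_id, Submodule.map_id]; exact fin_of_le le_rfl
    | succ j ih =>
      rw [pow_succ', Module.End.mul_eq_comp, Submodule.map_comp]
      exact fin_map _ ih
  -- This is the smallest `f`-stable subspace containing `A`. The sum is finite because `f ^ r = 0`,
  -- which keeps `L / A` finite dimensional.
  let L : Submodule K V := ⨆ j : Fin (r + 1), A.map (f ^ (j : ℕ))
  have hle : ∀ j : ℕ, A.map (f ^ j) ≤ L := by
    intro j
    rcases lt_or_ge j (r + 1) with h | h
    · exact le_iSup (fun j : Fin (r + 1) => A.map (f ^ (j : ℕ))) ⟨j, h⟩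
    · rw [pow_eq_zero_of_le (by omega) hr, Submodule.map_zero]
      exact bot_le
  have hfL : ∀ v ∈ L, f v ∈ L := by
    change L ≤ L.comap f
    refine iSup_le fun j => ?_
    rw [← Submodule.map_le_iff_le_comap, ← Submodule.map_comp, ← Module.End.mul_eq_comp, ← pow_succ']
    exact hle _
  -- Stability under `S` does not give stability under `S⁻¹` for an infinite dimensional `L`. Here
  -- it follows by induction on the order of nilpotency, from `S⁻¹ v = v - S⁻¹ (f v)`.
  have hinv : ∀ i : ℕ, ∀ v ∈ L, (f ^ i) v = 0 → S.symm v ∈ L := by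
    intro i
    induction i with
    | zero =>
      intro v _ h0
      have : v = 0 := h0
      rw [this, map_zero]
      exact L.zero_mem
    | succ i ih =>
      intro v hv h0
      have h1 := ih (f v) (hfL v hv) (by rw [← Module.End.mul_apply, ← pow_succ]; exact h0)
      have h2 : S.symm v = v - S.symm (f v) := by
        rw [hfS, map_sub, LinearEquiv.symm_apply_apply, sub_sub_cancel]
      rw [h2]
      exact L.sub_mem hv h1
  refine ⟨L, ?_, ?_, le_antisymm ?_ ?_⟩
  · have := hle 0
    rwa [pow_zero, Module.End.one_eq_id, Submodule.map_id] at this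
  · have : quo L A = ⨆ j : Fin (r + 1), quo (A.map (f ^ (j : ℕ))) A := Submodule.map_iSup _ _
    rw [this]
    infer_instance
  · rw [← map_eq_img]
    rintro _ ⟨v, hv, rfl⟩
    have h1 : S v = f v + v := by rw [hfS, sub_add_cancel]
    change S v ∈ L
    rw [h1]
    exact L.add_mem (hfL v hv) hv
  · intro v hv
    exact hinv r v hv (by rw [hr]; rfl)

/-- A finite dimensional difference does not change an infinite dimension, so `A ≃ L` and `V / A ≃ V
/ L`; complements assemble these into an automorphism of `V`. Both infiniteness hypotheses matter:
an automorphism cannot map a finite dimensional, or finite codimensional, `A` onto a strictly larger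
`L`. -/
theorem exists_img_eq {A L : Submodule K V} (hAL : A ≤ L) [FiniteDimensional K (quo L A)]
    (h1 : ¬ FiniteDimensional K A) (h2 : ¬ FiniteDimensional K (V ⧸ A)) :
    ∃ α : V ≃ₗ[K] V, img α A = L := by
  have hq : Module.rank K (quo L A) < Cardinal.aleph0 := Module.rank_lt_aleph0 K _
  -- Adding a finite cardinal `a` leaves `b` unchanged as soon as `b` is infinite, which also
  -- follows if the sum `c` is.
  have aux : ∀ a b c : Cardinal, a < Cardinal.aleph0 → a + b = c →
      (Cardinal.aleph0 ≤ b ∨ Cardinal.aleph0 ≤ c) → b = c := by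
    intro a b c ha hc hbc
    have hb : Cardinal.aleph0 ≤ b := by
      rcases hbc with h | h
      · exact h
      · by_contra hb
        rw [← hc] at h
        exact absurd (Cardinal.add_lt_aleph0 ha (not_le.1 hb)) (not_lt.2 h)
    rw [← hc, Cardinal.add_eq_right hb (ha.le.trans hb)]
  have inf_rank : ∀ {W : Type _} [AddCommGroup W] [Module K W], ¬ FiniteDimensional K W →
      Cardinal.aleph0 ≤ Module.rank K W := fun h => by
    rwa [← not_lt, Module.rank_lt_aleph0_iff]
  have e1 : Module.rank K A = Module.rank K L := by
    have h := LinearMap.rank_range_add_rank_ker (A.mkQ.domRestrict L)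
    have hr : LinearMap.range (A.mkQ.domRestrict L) = quo L A := by
      rw [LinearMap.domRestrict, LinearMap.range_comp, Submodule.range_subtype, quo]
    have hk : LinearMap.ker (A.mkQ.domRestrict L) = A.submoduleOf L := by
      rw [LinearMap.domRestrict, LinearMap.ker_comp, Submodule.ker_mkQ]
      rfl
    rw [hr, hk, (Submodule.submoduleOfEquivOfLe hAL).rank_eq] at h
    exact aux _ _ _ hq h (Or.inl (inf_rank h1))
  have e2 : Module.rank K (V ⧸ L) = Module.rank K (V ⧸ A) := by
    have h := LinearMap.rank_range_add_rank_ker (Submodule.factor hAL)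
    have hk : LinearMap.ker (Submodule.factor hAL) = quo L A :=
      le_antisymm (fun x hx => mem_quo_of_factor_eq_zero hAL hx)
        fun x hx => factor_eq_zero_of_mem_quo hAL hx
    rw [LinearMap.range_eq_top.2 (Submodule.factor_surjective hAL), rank_top, hk, add_comm] at h
    exact aux _ _ _ hq h (Or.inr (inf_rank h2))
  obtain ⟨ε⟩ := nonempty_linearEquiv_of_rank_eq e1
  obtain ⟨ε'⟩ := nonempty_linearEquiv_of_rank_eq e2
  obtain ⟨C, hC⟩ := A.exists_isCompl
  obtain ⟨C', hC'⟩ := L.exists_isCompl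
  let κ : C ≃ₗ[K] C' := (Submodule.quotientEquivOfIsCompl A C hC).symm ≪≫ₗ ε'.symm ≪≫ₗ
    Submodule.quotientEquivOfIsCompl L C' hC'
  let α : V ≃ₗ[K] V := (Submodule.prodEquivOfIsCompl A C hC).symm ≪≫ₗ ε.prodCongr κ ≪≫ₗ
    Submodule.prodEquivOfIsCompl L C' hC'
  have hα : ∀ a : A, α a = ε a := by
    intro a
    simp only [α, LinearEquiv.trans_apply, Submodule.prodEquivOfIsCompl_symm_apply_left]
    simp
  refine ⟨α, ?_⟩
  rw [← map_eq_img]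
  apply le_antisymm
  · rintro _ ⟨a, ha, rfl⟩
    change α (⟨a, ha⟩ : A) ∈ L
    rw [hα]
    exact (ε _).2
  · intro l hl
    refine ⟨ε.symm ⟨l, hl⟩, (ε.symm ⟨l, hl⟩).2, ?_⟩
    exact (hα _).trans (by rw [LinearEquiv.apply_symm_apply])

end

namespace GlTilde
section
variable {K : Type*} [Field K] {V : Type*} [AddCommGroup V] [Module K V] {Vp : Submodule K V}

theorem img_inf_eq_of_commute {S T : Gl Vp} (hST : S * T = T * S) (hS : img S.1 Vp = Vp) :
    img S.1 (img T.1 Vp ⊓ Vp) = img T.1 Vp ⊓ Vp := by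
  have e : img S.1 (img T.1 Vp) = img T.1 (img S.1 Vp) := congrArg (fun R : Gl Vp => img R.1 Vp) hST
  rw [img_inf, e, hS]

/-- Choose `L ⊇ V⁺` stable under `S` and `α` with `α(V⁺) = L`. After conjugation by `α` the pair
still commutes and `S` is still unipotent, but now `S(V⁺) = V⁺`, and both determinants in
`commutesUpTo_of_img_eq` are `1`. -/
theorem commutesUpTo_one_of_isNilpotent {S T : Gl Vp} (hST : S * T = T * S)
    (h : IsNilpotent ((S.1 : End K V) - 1)) (h1 : ¬ FiniteDimensional K Vp)
    (h2 : ¬ FiniteDimensional K (V ⧸ Vp)) : CommutesUpTo S T 1 := by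
  obtain ⟨L, hVL, fL, hSL⟩ := exists_img_eq_self S.1 Vp (commensurable_iff.1 (comm_img S)).1 h
  obtain ⟨α, hα⟩ := exists_img_eq hVL h1 h2
  have cL : Commensurable L Vp := commensurable_iff.2 ⟨fL, fin_of_le hVL⟩
  have hαL : img α⁻¹ L = Vp := by
    rw [← hα, ← img_mul, inv_mul_cancel, img_one]
  have cα : Commensurable (img α⁻¹ Vp) Vp := by
    have := cL.symm.img α⁻¹
    rwa [hαL] at this
  let β : Gl Vp := ⟨α, by rw [hα]; exact cL, cα⟩
  apply CommutesUpTo.of_conj (α := β)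
  have hc : β⁻¹ * S * β * (β⁻¹ * T * β) = β⁻¹ * T * β * (β⁻¹ * S * β) := by
    rw [show β⁻¹ * S * β * (β⁻¹ * T * β) = β⁻¹ * (S * T) * β by group, hST]
    group
  have hS : img (β⁻¹ * S * β).1 Vp = Vp := by
    change img α⁻¹ (img S.1 (img α Vp)) = Vp
    rw [hα, hSL, hαL]
  have hn : IsNilpotent (((β⁻¹ * S * β).1 : End K V) - 1) := by
    have e : ((β⁻¹ * S * β).1 : End K V) - 1 = α.symm.conjAlgEquiv K ((S.1 : End K V) - 1) := by
      rw [map_sub, map_one]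
      rfl
    rw [e]
    exact h.map _
  have hM := img_inf_eq_of_commute hc hS
  have cP : Commensurable (img (β⁻¹ * T * β).1 Vp ⊓ Vp) Vp :=
    (comm_img _).inf (Commensurable.refl _)
  have f1 := (comm_img (β⁻¹ * T * β)).fin cP
  have f2 := (Commensurable.refl Vp).fin cP
  have key := commutesUpTo_of_img_eq hc hS hM (a := 1) (b := 1)
    (fun x hx => by rw [extMap_eq_self _ hS hM hn hx, Units.val_one, one_smul])
    (fun x hx => by
      have hT : img (β⁻¹ * S * β).1 (img (β⁻¹ * T * β).1 Vp) = img (β⁻¹ * T * β).1 Vp := by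
        have e : img (β⁻¹ * S * β).1 (img (β⁻¹ * T * β).1 Vp)
            = img (β⁻¹ * T * β).1 (img (β⁻¹ * S * β).1 Vp) :=
          congrArg (fun R : Gl Vp => img R.1 Vp) hc
        rw [e, hS]
      rw [extMap_eq_self _ hT hM hn hx, Units.val_one, one_smul])
  rwa [div_one] at key

end
end GlTilde
end DetExt

/-! ### Auxiliary facts on lines, dimensions and norms -/

namespace DetExt

section
variable {K : Type*} [Field K] {V : Type*} [AddCommGroup V] [Module K V]

/-- For `A ⊆ M` the quotient is zero, so its line consists of the scalars in degree `0`, and algebra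
homomorphisms fix these. -/
theorem extMap_eq_self_of_le (S : V ≃ₗ[K] V) {A M : Submodule K V} (h : A ≤ M)
    (hM : img S M = M) {x : ExteriorAlgebra K (V ⧸ M)} (hx : x ∈ line A M) :
    extMap S hM x = x := by
  have e : finrank K (quo A M) = 0 := by rw [quo_eq_bot h, finrank_bot]
  rw [line, e, pow_zero] at hx
  obtain ⟨r, rfl⟩ := Submodule.mem_one.1 hx
  exact AlgHom.commutes _ r

/-- A family with a dual system of linear maps is independent. The maps take values in `U`, so that
the `k'`-valued coefficients of a series can serve directly. -/
theorem not_finiteDimensional_of_dual {W U : Type*} [AddCommGroup W] [Module K W] [AddCommGroup U]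
    [Module K U] {u : U} (hu : u ≠ 0) (e : ℕ → W) (c : ℕ → W →ₗ[K] U)
    (h : ∀ i j, c i (e j) = if j = i then u else 0) : ¬ FiniteDimensional K W := by
  intro hW
  have hl : LinearIndependent K e := by
    rw [linearIndependent_iff']
    intro s g hg i hi
    have h1 := congrArg (c i) hg
    rw [map_sum, map_zero] at h1
    simp only [map_smul, h, smul_ite, smul_zero, Finset.sum_ite_eq', if_pos hi] at h1
    exact (smul_eq_zero.1 h1).resolve_right hu
  have := hl.finite
  exact not_finite ℕ

end

section
variable {k : Type*} [Field k] {k' : Type*} [CommRing k'] [Algebra k k']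

/-- The quotient `a / b` is `1` plus a nilpotent, so multiplication by it is unipotent. -/
theorem norm_eq_of_isNilpotent_sub [Module.Finite k k'] {a b : k'} (hb : IsUnit b)
    (h : IsNilpotent (a - b)) : Algebra.norm k a = Algebra.norm k b := by
  obtain ⟨b, rfl⟩ := hb
  have h1 : Algebra.norm k (a * (b⁻¹ : k'ˣ)) = 1 := by
    apply norm_eq_one_of_isNilpotent_sub_one
    have e : a * (b⁻¹ : k'ˣ) - 1 = (b⁻¹ : k'ˣ) * (a - b) := by
      rw [mul_sub, Units.inv_mul, mul_comm]
    rw [e]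
    exact (Commute.all _ _).isNilpotent_mul_left h
  calc Algebra.norm k a = Algebra.norm k (a * (b⁻¹ : k'ˣ) * b) := by rw [Units.inv_mul_cancel_right]
    _ = _ := by rw [map_mul, h1, one_mul]

/-! ### Coefficients of Laurent series and factorisation of units -/

section coefficients

/-- The coefficient functional `f ↦ f_n`. -/
def coeffLin (k : Type*) [Field k] {k' : Type*} [CommRing k'] [Algebra k k'] (n : ℤ) :
    LaurentSeries k' →ₗ[k] k' where
  toFun f := f.coeff n
  map_add' _ _ := HahnSeries.coeff_add
  map_smul' _ _ := rfl

theorem not_finiteDimensional_powerSeriesLattice [Nontrivial k'] :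
    ¬ FiniteDimensional k (powerSeriesLattice k k') := by
  refine not_finiteDimensional_of_dual (u := (1 : k')) one_ne_zero
    (fun n => ⟨HahnSeries.single (n : ℤ) 1, fun m hm => ?_⟩)
    (fun n => coeffLin k n ∘ₗ (powerSeriesLattice k k').subtype) fun i j => ?_
  · rw [HahnSeries.coeff_single_of_ne]
    omega
  · change (HahnSeries.single (j : ℤ) (1 : k')).coeff i = _
    rw [HahnSeries.coeff_single]
    simp only [Nat.cast_inj, eq_comm]

theorem not_finiteDimensional_quotient_powerSeriesLattice [Nontrivial k'] :
    ¬ FiniteDimensional k (LaurentSeries k' ⧸ powerSeriesLattice k k') := by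
  refine not_finiteDimensional_of_dual (u := (1 : k')) one_ne_zero
    (fun n => (powerSeriesLattice k k').mkQ (HahnSeries.single (-(n : ℤ) - 1) 1))
    (fun n => (powerSeriesLattice k k').liftQ (coeffLin k (-(n : ℤ) - 1))
      fun f hf => hf _ (by omega)) fun i j => ?_
  change (HahnSeries.single (-(j : ℤ) - 1) (1 : k')).coeff (-(i : ℤ) - 1) = _
  split_ifs with h
  · rw [h, HahnSeries.coeff_single_same]
  · exact HahnSeries.coeff_single_of_ne (by omega)

variable (k')

/-- The Laurent series whose coefficients are nilpotent. -/
def nilpotentCoeffs : Ideal (LaurentSeries k') where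
  carrier := {f | ∀ n, f.coeff n ∈ nilradical k'}
  zero_mem' _ := zero_mem _
  add_mem' {f g} hf hg n := by rw [HahnSeries.coeff_add]; exact add_mem (hf n) (hg n)
  smul_mem' f g hg n := by
    rw [smul_eq_mul, HahnSeries.coeff_mul]
    exact sum_mem fun ij _ => Ideal.mul_mem_left _ _ (hg _)

/-- The units `z ^ n` of `k'((z))`. -/
noncomputable def zPow : Multiplicative ℤ →* (LaurentSeries k')ˣ where
  toFun n := ⟨HahnSeries.single n.toAdd 1, HahnSeries.single (-n.toAdd) 1,
    by rw [HahnSeries.single_mul_single]; simp, by rw [HahnSeries.single_mul_single]; simp⟩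
  map_one' := Units.ext (by simp)
  map_mul' a b := Units.ext (by simp [HahnSeries.single_mul_single])

/-- The element `z` of `k'((z))`. -/
noncomputable def zUnit : (LaurentSeries k')ˣ := zPow k' (Multiplicative.ofAdd 1)

variable {k'}

theorem coe_zUnit_zpow (n : ℤ) :
    ((zUnit k' ^ n : (LaurentSeries k')ˣ) : LaurentSeries k') = HahnSeries.single n 1 := by
  rw [zUnit, ← map_zpow, ← ofAdd_zsmul, smul_eq_mul, mul_one]
  rfl

/-- The invertible power series, as units of `k'((z))`. -/
noncomputable def ofUnit : (PowerSeries k')ˣ →* (LaurentSeries k')ˣ :=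
  Units.map (HahnSeries.ofPowerSeries ℤ k' : PowerSeries k' →* LaurentSeries k')

theorem coe_ofUnit (u : (PowerSeries k')ˣ) :
    (ofUnit u : LaurentSeries k') = HahnSeries.ofPowerSeries ℤ k' u := rfl

/-- The constant coefficient of an invertible power series. -/
noncomputable def constUnit : (PowerSeries k')ˣ →* k'ˣ :=
  Units.map (PowerSeries.constantCoeff : PowerSeries k' →+* k').toMonoidHom

theorem coeff_ofPowerSeries_zero (p : PowerSeries k') :
    (HahnSeries.ofPowerSeries ℤ k' p).coeff 0 = PowerSeries.constantCoeff p := by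
  have := HahnSeries.ofPowerSeries_apply_coeff (Γ := ℤ) p 0
  rwa [Nat.cast_zero, PowerSeries.coeff_zero_eq_constantCoeff_apply] at this

theorem coeff_ofPowerSeries_of_neg (p : PowerSeries k') {n : ℤ} (h : n < 0) :
    (HahnSeries.ofPowerSeries ℤ k' p).coeff n = 0 := by
  rw [HahnSeries.ofPowerSeries_apply]
  apply HahnSeries.embDomain_of_notMem_range
  rintro ⟨m, rfl⟩
  exact absurd h (not_lt.2 (Int.natCast_nonneg m))

theorem mem_powerSeriesLattice_iff {f : LaurentSeries k'} :
    f ∈ powerSeriesLattice k k' ↔ ∃ p, HahnSeries.ofPowerSeries ℤ k' p = f := by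
  constructor
  · intro hf
    refine ⟨PowerSeries.mk fun n => f.coeff n, HahnSeries.ext (funext fun n => ?_)⟩
    rcases lt_or_ge n 0 with h | h
    · rw [hf n h, coeff_ofPowerSeries_of_neg _ h]
    · lift n to ℕ using h
      rw [HahnSeries.ofPowerSeries_apply_coeff, PowerSeries.coeff_mk]
  · rintro ⟨p, rfl⟩ n h
    exact coeff_ofPowerSeries_of_neg _ h

/-- After division by `z ^ val S` the coefficients of negative degree are nilpotent and the constant
one is a unit. The part of nonnegative degree is then an invertible power series `u`, and the
remainder `f` gives `N = 1 + u⁻¹ f`. Nilpotency of `N - 1` serves the commutator, nilpotency of its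
coefficients serves the constant coefficient of `S ^ b / T ^ a`. -/
theorem exists_decomposition {S : (LaurentSeries k')ˣ} (hS : HasUnitLeadingCoeff S) :
    ∃ (u : (PowerSeries k')ˣ) (N : (LaurentSeries k')ˣ), S = zUnit k' ^ val S * ofUnit u * N ∧
      IsNilpotent ((N : LaurentSeries k') - 1) ∧ (N : LaurentSeries k') - 1 ∈ nilpotentCoeffs k' := by
  set n := val S with hn
  set S₁ : (LaurentSeries k')ˣ := (zUnit k' ^ n)⁻¹ * S with hS₁
  have hc : ∀ i, (S₁ : LaurentSeries k').coeff i = (S : LaurentSeries k').coeff (i + n) := by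
    intro i
    rw [hS₁, ← zpow_neg, Units.val_mul, coe_zUnit_zpow, HahnSeries.coeff_single_mul, one_mul,
      sub_neg_eq_add]
  have hneg : ∀ i < 0, (S₁ : LaurentSeries k').coeff i ∈ nilradical k' := by
    intro i hi
    rw [hc, ← Ideal.Quotient.eq_zero_iff_mem]
    exact HahnSeries.coeff_eq_zero_of_lt_order (x := reduction (S : LaurentSeries k'))
      (show i + n < n by omega)
  have h0 : IsUnit ((S₁ : LaurentSeries k').coeff 0) := by
    rw [hc, zero_add]
    rw [HasUnitLeadingCoeff, HahnSeries.leadingCoeff_eq] at hS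
    -- Units lift along the nilradical: a product congruent to `1` is `1` plus a nilpotent, hence a
    -- unit.
    obtain ⟨y, hy⟩ := hS.exists_right_inv
    obtain ⟨y, rfl⟩ := Ideal.Quotient.mk_surjective y
    change Ideal.Quotient.mk (nilradical k') ((S : LaurentSeries k').coeff n) * _ = 1 at hy
    rw [← map_mul, ← map_one (Ideal.Quotient.mk (nilradical k')), Ideal.Quotient.eq,
      mem_nilradical] at hy
    have := hy.isUnit_add_one
    rw [sub_add_cancel] at this
    exact isUnit_of_mul_isUnit_left this
  set p : PowerSeries k' := PowerSeries.mk fun i => (S₁ : LaurentSeries k').coeff i with hp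
  have hpu : IsUnit p := by
    rw [PowerSeries.isUnit_iff_constantCoeff, ← PowerSeries.coeff_zero_eq_constantCoeff_apply, hp,
      PowerSeries.coeff_mk]
    exact h0
  obtain ⟨u, hu⟩ := hpu
  set f : LaurentSeries k' := S₁ - ofUnit u with hf
  have hfnn : ∀ i, 0 ≤ i → f.coeff i = 0 := by
    intro i hi
    lift i to ℕ using hi
    rw [hf, HahnSeries.coeff_sub, coe_ofUnit, hu, HahnSeries.ofPowerSeries_apply_coeff, hp,
      PowerSeries.coeff_mk, sub_self]
  have hfneg : ∀ i < 0, f.coeff i = (S₁ : LaurentSeries k').coeff i := by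
    intro i hi
    have : (ofUnit u : LaurentSeries k').coeff i = 0 :=
      coeff_ofPowerSeries_of_neg _ hi
    rw [hf, HahnSeries.coeff_sub, this, sub_zero]
  have hfJ : f ∈ nilpotentCoeffs k' := by
    intro i
    rcases lt_or_ge i 0 with h | h
    · rw [hfneg i h]; exact hneg i h
    · rw [hfnn i h]; exact zero_mem _
  have hfnil : IsNilpotent f := by
    -- Nilpotent coefficients alone need not make a series nilpotent; here `f` has only finitely
    -- many terms, all of negative degree.
    have e : f = ∑ i ∈ Finset.Ico f.order 0, HahnSeries.single i (f.coeff i) := by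
      ext j
      rw [HahnSeries.coeff_sum, Finset.sum_eq_single j, HahnSeries.coeff_single_same]
      · exact fun i _ hij => HahnSeries.coeff_single_of_ne hij.symm
      · intro h
        rw [Finset.mem_Ico] at h
        rw [HahnSeries.coeff_single_same]
        rcases lt_or_ge j 0 with h' | h'
        · exact HahnSeries.coeff_eq_zero_of_lt_order (by omega)
        · exact hfnn j h'
    rw [e]
    refine isNilpotent_sum fun i _ => ?_
    obtain ⟨r, hr⟩ := mem_nilradical.1 (hfJ i)
    exact ⟨r, by rw [HahnSeries.single_pow, hr, map_zero]⟩
  have hN : (((ofUnit u)⁻¹ * S₁ : (LaurentSeries k')ˣ) : LaurentSeries k') - 1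
      = ((ofUnit u)⁻¹ : (LaurentSeries k')ˣ) * f := by
    rw [hf, mul_sub, Units.inv_mul, Units.val_mul]
  refine ⟨u, (ofUnit u)⁻¹ * S₁, by rw [hS₁]; group, ?_, ?_⟩
  · rw [hN]
    exact (Commute.all _ _).isNilpotent_mul_left hfnil
  · rw [hN]
    exact Ideal.mul_mem_left _ _ hfJ

end coefficients

/-- The nilradical is the maximal ideal, so the reduction has coefficients in a field and only has
to be nonzero. If it vanished, `S` would lie in the ideal `nilpotentCoeffs k'`, and so would `S⁻¹ S
= 1`. -/
theorem hasUnitLeadingCoeff_of_isLocalRing [IsArtinianRing k'] [IsLocalRing k']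
    (S : (LaurentSeries k')ˣ) : HasUnitLeadingCoeff S := by
  have hm : (nilradical k').IsMaximal := by
    rw [Ring.KrullDimLE.nilradical_eq_maximalIdeal]
    infer_instance
  let _ : Field (k' ⧸ nilradical k') := Ideal.Quotient.field _
  rw [HasUnitLeadingCoeff, isUnit_iff_ne_zero, HahnSeries.leadingCoeff_ne_zero]
  intro h
  have hS : (S : LaurentSeries k') ∈ nilpotentCoeffs k' := fun n => by
    rw [← Ideal.Quotient.eq_zero_iff_mem]
    exact congrArg (fun f => HahnSeries.coeff f n) h
  have h1 := Ideal.mul_mem_left _ ((S⁻¹ : (LaurentSeries k')ˣ) : LaurentSeries k') hS 0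
  rw [Units.inv_mul, HahnSeries.coeff_one, if_pos rfl, mem_nilradical] at h1
  exact not_isNilpotent_one h1

theorem coe_mulEquiv_sub_one_pow (N : (LaurentSeries k')ˣ) (r : ℕ) (f : LaurentSeries k') :
    (((mulEquiv k N : End k (LaurentSeries k')) - 1) ^ r) f
      = ((N : LaurentSeries k') - 1) ^ r * f := by
  induction r generalizing f with
  | zero => rw [pow_zero, pow_zero, one_mul]; rfl
  | succ r ih =>
    rw [pow_succ, Module.End.mul_apply, ih, pow_succ, mul_assoc, sub_mul _ _ f, one_mul]
    rfl

/-! ### Commutators of homotheties -/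

section
variable [Module.Finite k k']

theorem homothety_mul_comm (S T : (LaurentSeries k')ˣ) :
    homothety k S * homothety k T = homothety k T * homothety k S := by
  rw [← map_mul, mul_comm, map_mul]

theorem img_homothety_ofUnit (u : (PowerSeries k')ˣ) :
    img (homothety k (ofUnit u)).1 (powerSeriesLattice k k') = powerSeriesLattice k k' := by
  have key : ∀ (v : (PowerSeries k')ˣ), ∀ f ∈ powerSeriesLattice k k',
      (ofUnit v : LaurentSeries k') * f ∈ powerSeriesLattice k k' := by
    intro v f hf
    obtain ⟨p, rfl⟩ := mem_powerSeriesLattice_iff.1 hf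
    exact mem_powerSeriesLattice_iff.2 ⟨v * p, map_mul _ _ _⟩
  apply le_antisymm
  · intro f hf
    have := key u _ hf
    change (ofUnit u : LaurentSeries k') * (((ofUnit u)⁻¹ : (LaurentSeries k')ˣ) * f) ∈
      powerSeriesLattice k k' at this
    rwa [Units.mul_inv_cancel_left] at this
  · intro f hf
    change ((ofUnit u)⁻¹ : (LaurentSeries k')ˣ) * f ∈ powerSeriesLattice k k'
    rw [← map_inv]
    exact key _ _ hf

theorem mem_img_homothety_zUnit {f : LaurentSeries k'} :
    f ∈ img (homothety k (zUnit k')).1 (powerSeriesLattice k k') ↔ ∀ n ≤ 0, f.coeff n = 0 := by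
  change (∀ n < 0, (((zUnit k')⁻¹ : (LaurentSeries k')ˣ) * f).coeff n = 0) ↔ _
  have e : ∀ n, ((((zUnit k')⁻¹ : (LaurentSeries k')ˣ) : LaurentSeries k') * f).coeff n
      = f.coeff (n + 1) := by
    intro n
    rw [← zpow_neg_one, coe_zUnit_zpow, HahnSeries.coeff_single_mul, one_mul, sub_neg_eq_add]
  simp only [e]
  constructor
  · intro h n hn
    have := h (n - 1) (by omega)
    rwa [sub_add_cancel] at this
  · exact fun h n hn => h _ (by omega)

/-- The constant coefficient identifies `V⁺ / zV⁺` with `k'`, and `u` then acts as multiplication by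
`u(0)`. -/
theorem det_quoEnd_homothety_ofUnit (u : (PowerSeries k')ˣ) (M : Submodule k (LaurentSeries k'))
    (hMz : M = img (homothety k (zUnit k')).1 (powerSeriesLattice k k') ⊓ powerSeriesLattice k k')
    (hM : img (homothety k (ofUnit u)).1 M = M) :
    LinearMap.det (quoEnd (homothety k (ofUnit u)).1 (img_homothety_ofUnit u) hM)
      = Algebra.norm k (constUnit u : k') := by
  have hM0 : M ≤ LinearMap.ker (coeffLin k (k' := k') 0) := by
    rw [hMz]
    exact fun f hf => mem_img_homothety_zUnit.1 hf.1 0 le_rfl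
  let e₀ : quo (powerSeriesLattice k k') M →ₗ[k] k' := (M.liftQ _ hM0).domRestrict _
  have he₀ : ∀ (p : PowerSeries k') (x : quo (powerSeriesLattice k k') M),
      (x : LaurentSeries k' ⧸ M) = M.mkQ (HahnSeries.ofPowerSeries ℤ k' p) →
      e₀ x = PowerSeries.constantCoeff p := by
    intro p x hx
    change M.liftQ _ hM0 (x : LaurentSeries k' ⧸ M) = _
    rw [hx]
    exact coeff_ofPowerSeries_zero p
  have hx : ∀ x : quo (powerSeriesLattice k k') M, ∃ p : PowerSeries k',
      (x : LaurentSeries k' ⧸ M) = M.mkQ (HahnSeries.ofPowerSeries ℤ k' p) := by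
    rintro ⟨_, v, hv, rfl⟩
    obtain ⟨p, rfl⟩ := mem_powerSeriesLattice_iff.1 hv
    exact ⟨p, rfl⟩
  have hb : Function.Bijective e₀ := by
    constructor
    · rw [injective_iff_map_eq_zero]
      intro x h0
      obtain ⟨p, hp⟩ := hx x
      rw [he₀ p x hp] at h0
      apply Subtype.ext
      rw [hp]
      refine (Submodule.Quotient.mk_eq_zero M).2 ?_
      rw [hMz]
      refine ⟨mem_img_homothety_zUnit.2 fun n hn => ?_, mem_powerSeriesLattice_iff.2 ⟨p, rfl⟩⟩
      rcases hn.lt_or_eq with h | rfl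
      · exact coeff_ofPowerSeries_of_neg p h
      · rw [coeff_ofPowerSeries_zero, h0]
    · intro c
      refine ⟨⟨M.mkQ (HahnSeries.ofPowerSeries ℤ k' (PowerSeries.C c)), _,
        mem_powerSeriesLattice_iff.2 ⟨_, rfl⟩, rfl⟩, ?_⟩
      rw [he₀ _ _ rfl, PowerSeries.constantCoeff_C]
  let e := LinearEquiv.ofBijective e₀ hb
  have key : (e : _ →ₗ[k] k') ∘ₗ quoEnd (homothety k (ofUnit u)).1 (img_homothety_ofUnit u) hM
      ∘ₗ (e.symm : k' →ₗ[k] _) = LinearMap.mulLeft k (constUnit u : k') := by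
    refine LinearMap.ext fun c => ?_
    obtain ⟨x, rfl⟩ := e.surjective c
    obtain ⟨p, hp⟩ := hx x
    have h1 : e₀ (quoEnd (homothety k (ofUnit u)).1 (img_homothety_ofUnit u) hM x)
        = PowerSeries.constantCoeff ((u : PowerSeries k') * p) := by
      apply he₀
      change quoMap (homothety k (ofUnit u)).1 hM (x : LaurentSeries k' ⧸ M) = _
      rw [hp, quoMap_mkQ, map_mul]
      rfl
    rw [LinearMap.comp_apply, LinearMap.comp_apply, LinearEquiv.coe_coe, LinearEquiv.coe_coe,
      LinearEquiv.symm_apply_apply]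
    refine h1.trans ?_
    rw [map_mul]
    exact congrArg _ (he₀ p x hp).symm
  rw [← LinearMap.det_conj _ e, key, Algebra.norm_apply]
  rfl

open GlTilde

/-- Both series preserve `V⁺`, so the two lines in `commutesUpTo_of_img_eq` have degree `0`. -/
theorem commutesUpTo_ofUnit_ofUnit (u v : (PowerSeries k')ˣ) :
    CommutesUpTo (homothety k (ofUnit u)) (homothety k (ofUnit v)) 1 := by
  have h := homothety_mul_comm (k := k) (ofUnit u) (ofUnit v)
  have hS := img_homothety_ofUnit (k := k) u
  have hT := img_homothety_ofUnit (k := k) v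
  have hM := img_inf_eq_of_commute h hS
  have key := commutesUpTo_of_img_eq h hS hM (a := 1) (b := 1)
    (fun x hx => by
      rw [extMap_eq_self_of_le _ (by rw [hT, inf_idem]) hM hx, Units.val_one, one_smul])
    (fun x hx => by
      rw [extMap_eq_self_of_le _ (by rw [hT, inf_idem]) hM hx, Units.val_one, one_smul])
  rwa [div_one] at key

/-- Here `P = zV⁺`: the numerator is the determinant of `u` on `V⁺ / zV⁺`, and the denominator
belongs to the zero space `zV⁺ / zV⁺`. -/
theorem commutesUpTo_ofUnit_zUnit (u : (PowerSeries k')ˣ) :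
    CommutesUpTo (homothety k (ofUnit u)) (homothety k (zUnit k'))
      (Units.map (Algebra.norm k : k' →* k) (constUnit u)) := by
  have h := homothety_mul_comm (k := k) (ofUnit u) (zUnit k')
  have hS := img_homothety_ofUnit (k := k) u
  have hM := img_inf_eq_of_commute h hS
  have hz : img (homothety k (zUnit k')).1 (powerSeriesLattice k k') ≤ powerSeriesLattice k k' :=
    fun f hf n hn => mem_img_homothety_zUnit.1 hf n hn.le
  have cP : Commensurable (img (homothety k (zUnit k')).1 (powerSeriesLattice k k') ⊓
    powerSeriesLattice k k') (powerSeriesLattice k k') := (comm_img _).inf (Commensurable.refl _)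
  have f2 := (Commensurable.refl (powerSeriesLattice k k')).fin cP
  have key := commutesUpTo_of_img_eq h hS hM
    (a := Units.map (Algebra.norm k : k' →* k) (constUnit u)) (b := 1)
    (fun x hx => by
      rw [extMap_eq_det_smul _ hS hM hx, det_quoEnd_homothety_ofUnit u _ rfl hM]
      rfl)
    (fun x hx => by
      rw [extMap_eq_self_of_le _ (le_inf le_rfl hz) hM hx, Units.val_one, one_smul])
  rwa [div_one] at key

theorem commutesUpTo_of_isNilpotent_sub_one {N : (LaurentSeries k')ˣ}
    (h : IsNilpotent ((N : LaurentSeries k') - 1)) (T : (LaurentSeries k')ˣ) :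
    CommutesUpTo (homothety k N) (homothety k T) 1 := by
  -- For `k' = 0` the space `V` is zero and the infinite dimensionality fails, but then `N = 1`.
  rcases subsingleton_or_nontrivial k' with hk | hk
  · have : Subsingleton (LaurentSeries k') :=
      ⟨fun f g => HahnSeries.ext (funext fun n => Subsingleton.elim _ _)⟩
    rw [show N = 1 from Units.ext (Subsingleton.elim _ _), map_one]
    exact CommutesUpTo.one_left _
  · refine commutesUpTo_one_of_isNilpotent (homothety_mul_comm N T) ?_
      not_finiteDimensional_powerSeriesLattice not_finiteDimensional_quotient_powerSeriesLattice
    obtain ⟨r, hr⟩ := h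
    refine ⟨r, LinearMap.ext fun f => ?_⟩
    refine (coe_mulEquiv_sub_one_pow N r f).trans ?_
    rw [hr, zero_mul]
    rfl

/-- By bimultiplicativity only the pairs `(u, z)` and `(z, v)` contribute: the first gives the norm
of `u(0)` to the power `b`, the second the inverse norm of `v(0)` to the power `a`. -/
theorem commutesUpTo_of_decomposition {u v : (PowerSeries k')ˣ} {M N : (LaurentSeries k')ˣ}
    (hM : IsNilpotent ((M : LaurentSeries k') - 1)) (hN : IsNilpotent ((N : LaurentSeries k') - 1))
    (a b : ℤ) : CommutesUpTo (homothety k (zUnit k' ^ a * ofUnit u * M))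
      (homothety k (zUnit k' ^ b * ofUnit v * N))
      (Units.map (Algebra.norm k : k' →* k) (constUnit (u ^ b / v ^ a))) := by
  have hz := (((CommutesUpTo.refl (homothety k (zUnit k'))).zpow_right b).mul_right
    (commutesUpTo_ofUnit_zUnit (k := k) v).symm).mul_right
      (commutesUpTo_of_isNilpotent_sub_one (k := k) hN (zUnit k')).symm
  have hu := (((commutesUpTo_ofUnit_zUnit (k := k) u).zpow_right b).mul_right
    (commutesUpTo_ofUnit_ofUnit u v)).mul_right
      (commutesUpTo_of_isNilpotent_sub_one (k := k) hN (ofUnit u)).symm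
  have hm := commutesUpTo_of_isNilpotent_sub_one (k := k) hM (zUnit k' ^ b * ofUnit v * N)
  rw [← map_zpow, ← map_mul, ← map_mul] at hz hu
  have key := ((hz.zpow_left a).mul_left hu).mul_left hm
  rw [← map_zpow, ← map_mul, ← map_mul] at key
  have e : Units.map (Algebra.norm k : k' →* k) (constUnit (u ^ b / v ^ a))
      = (1 ^ b * (Units.map (Algebra.norm k : k' →* k) (constUnit v))⁻¹ * 1⁻¹) ^ a *
        (Units.map (Algebra.norm k : k' →* k) (constUnit u) ^ b * 1 * 1⁻¹) * 1 := by
    simp only [map_div, map_zpow, one_zpow, one_mul, inv_one, mul_one, inv_zpow]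
    rw [div_eq_inv_mul]
  rw [e]
  exact key

/-- The powers `z ^ (a * b)` cancel, and `M`, `N` become `1` modulo `nilpotentCoeffs k'`. The two
constant coefficients therefore differ by a nilpotent, which the norm ignores. -/
theorem norm_coeff_zero_of_decomposition {u v : (PowerSeries k')ˣ} {M N : (LaurentSeries k')ˣ}
    (hM : (M : LaurentSeries k') - 1 ∈ nilpotentCoeffs k')
    (hN : (N : LaurentSeries k') - 1 ∈ nilpotentCoeffs k') (a b : ℤ) :
    Algebra.norm k (HahnSeries.coeff (((zUnit k' ^ a * ofUnit u * M) ^ b /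
      (zUnit k' ^ b * ofUnit v * N) ^ a : (LaurentSeries k')ˣ) : LaurentSeries k') 0)
      = Algebra.norm k (constUnit (u ^ b / v ^ a) : k') := by
  let q := Units.map (Ideal.Quotient.mk (nilpotentCoeffs k')).toMonoidHom
  have hq : ∀ {L : (LaurentSeries k')ˣ}, (L : LaurentSeries k') - 1 ∈ nilpotentCoeffs k' →
      q L = 1 := by
    intro L hL
    apply Units.ext
    have := Ideal.Quotient.eq.2 hL
    rw [map_one] at this
    exact this
  have e : q ((zUnit k' ^ a * ofUnit u * M) ^ b / (zUnit k' ^ b * ofUnit v * N) ^ a)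
      = q (ofUnit (u ^ b / v ^ a)) := by
    have e' : (zUnit k' ^ a * ofUnit u * M) ^ b / (zUnit k' ^ b * ofUnit v * N) ^ a
        = ofUnit (u ^ b / v ^ a) * (M ^ b / N ^ a) := by
      rw [mul_zpow, mul_zpow, mul_zpow, mul_zpow, ← zpow_mul, ← zpow_mul, mul_comm b a, mul_assoc,
        mul_assoc, mul_div_mul_left_eq_div, map_div, map_zpow, map_zpow, mul_div_mul_comm]
    have h1 : M ^ b / N ^ a ∈ q.ker := div_mem (zpow_mem (hq hM) b) (zpow_mem (hq hN) a)
    rw [e', map_mul, MonoidHom.mem_ker.1 h1, mul_one]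
  have h0 := Ideal.Quotient.eq.1 (congrArg Units.val e) 0
  rw [HahnSeries.coeff_sub, coe_ofUnit, coeff_ofPowerSeries_zero, mem_nilradical] at h0
  exact norm_eq_of_isNilpotent_sub (constUnit (u ^ b / v ^ a)).isUnit h0

end

end
end DetExt

/-! ### The commutator formula -/

theorem propositionp {k : Type*} [Field k] {k' : Type*} [CommRing k'] [Algebra k k']
    [Module.Finite k k'] :
    (∀ S T : (LaurentSeries k')ˣ, DetExt.HasUnitLeadingCoeff S → DetExt.HasUnitLeadingCoeff T →
      ∀ S' T' : DetExt.GlTilde (DetExt.powerSeriesLattice k k'),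
        DetExt.GlTilde.proj S' = DetExt.homothety k S →
        DetExt.GlTilde.proj T' = DetExt.homothety k T →
        ∃ c : kˣ, S' * T' * S'⁻¹ * T'⁻¹ = DetExt.GlTilde.scalar c ∧
          (c : k) = Algebra.norm k
            (HahnSeries.coeff ((S ^ DetExt.val T / T ^ DetExt.val S : (LaurentSeries k')ˣ) :
              LaurentSeries k') 0)) ∧
    (IsLocalRing k' → ∀ S : (LaurentSeries k')ˣ, DetExt.HasUnitLeadingCoeff S) := by
  refine ⟨fun S T hS hT S' T' hS' hT' => ?_, fun _ S => ?_⟩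
  · obtain ⟨u, M, eS, hM, hM'⟩ := DetExt.exists_decomposition hS
    obtain ⟨v, N, eT, hN, hN'⟩ := DetExt.exists_decomposition hT
    -- The valuations occur only as exponents. Replacing them by arbitrary integers removes the
    -- dependence of the right-hand sides of `eS` and `eT` on `S` and `T`, which can then be
    -- substituted.
    generalize DetExt.val S = a at *
    generalize DetExt.val T = b at *
    subst eS eT
    refine ⟨Units.map (Algebra.norm k : k' →* k) (DetExt.constUnit (u ^ b / v ^ a)), ?_,
      (DetExt.norm_coeff_zero_of_decomposition (u := u) (v := v) hM' hN' a b).symm⟩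
    rw [(DetExt.commutesUpTo_of_decomposition hM hN a b).mul_eq hS' hT']
    simp only [mul_assoc, mul_inv_cancel, mul_one]
  · have : IsArtinianRing k' := IsArtinianRing.of_finite k k'
    exact DetExt.hasUnitLeadingCoeff_of_isLocalRing S
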